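/- Fix $n\ge 1$ and consider an $n\times n$ input-queued switch in discrete time with queue lengths $q(t)\in\mathbb Z_{\ge0}^{n\times n}$. In slot $t$, $a_{ij}(t)$ packets arrive at queue $(i,j)$; the $a_{ij}(t)$ are nonnegative integers, bounded by a constant $a_{\max}$, i.i.d. over $t$ and independent over $(i,j)$. The MaxWeight algorithm picks a permutation matrix $s(t)$ that maximizes $\langle q(t),s\rangle$ over all permutation matrices $s$ (ties are broken by an arbitrary, possibly random, rule depending only on $q(t)$), and $q_{ij}(t+1)=\max\{q_{ij}(t)+a_{ij}(t)-s_{ij}(t),0\}$; given $q(t)$, the choice of $s(t)$ is independent of $a(t)$. A steady-state queue length matrix $\bar q$ is a random matrix whose law is an invariant probability distribution of the Markov chain $q(t)$. Let $\nu$ be a point in the relative interior of the set of doubly stochastic $n\times n$ matrices (all ports saturated) with $\nu_{\min}=\min_{ij}\nu_{ij}>0$, and let $k\in\mathbb R_{\ge 0}^{n\times n}$ with $\sum_{ij}k_{ij}=n$; put $\kappa_i=\sum_jk_{ij}$, $\tilde\kappa_j=\sum_ik_{ij}$, $\|k\|^2=\sum_{ij}k_{ij}^2$ and $\epsilon_0=\nu_{\min}/(2\|k\|)$.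 For $0<\epsilon\le\epsilon_0$ consider switches under MaxWeight whose arrivals, bounded by the same $a_{\max}$, have mean matrix $\lambda^{(\epsilon)}=\nu-\epsilon k$ and variances $(\sigma^{(\epsilon)}_{ij})^2$; write $\|\sigma^{(\epsilon)}\|^2=\sum_{ij}(\sigma^{(\epsilon)}_{ij})^2$. (a) If all $\kappa_i$ and $\tilde\kappa_j$ are positive, then for each such switch the Markov chain $q(t)$ has exactly one invariant probability distribution. (b) Let $\alpha\in\mathbb R^{n\times n}$ satisfy $\sum_j\alpha_{ij}=n\kappa_i$ for all $i$ and $\sum_i\alpha_{ij}=n\tilde\kappa_j$ for all $j$ (negative entries are allowed). There are functions $B_3,B_4$ of $\epsilon$, depending only on $n,\nu,k,a_{\max},\alpha$, with $\lim_{\epsilon\downarrow0}\epsilon B_3(\epsilon)=\lim_{\epsilon\downarrow0}\epsilon B_4(\epsilon)=0$, such that for all $0<\epsilon\le\epsilon_0$ and every such switch with a steady-state queue length matrix $\bar q^{(\epsilon)}$, the variable $\langle\bar q^{(\epsilon)},\alpha\rangle=\sum_{ij}\alpha_{ij}\bar q^{(\epsilon)}_{ij}$ is integrable and $$\Bigl(1-\frac1{2n}\Bigr)\frac{\|\sigma^{(\epsilon)}\|^2}{\epsilon}-B_3(\epsilon)\le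 \mathbb E\bigl[\langle\bar q^{(\epsilon)},\alpha\rangle\bigr]\le\Bigl(1-\frac1{2n}\Bigr)\frac{\|\sigma^{(\epsilon)}\|^2}{\epsilon}+B_4(\epsilon).$$ (c) Consequently, for $\alpha$ as in (b) and any family of such switches, one for each $0<\epsilon\le\epsilon_0$, with steady-state matrices $\bar q^{(\epsilon)}$ and $(\sigma^{(\epsilon)}_{ij})^2\to\sigma_{ij}^2$ for all $i,j$ as $\epsilon\downarrow0$, $$\lim_{\epsilon\downarrow0}\epsilon\,\mathbb E\bigl[\langle\bar q^{(\epsilon)},\alpha\rangle\bigr]=\Bigl(1-\frac1{2n}\Bigr)\|\sigma\|^2,\qquad \|\sigma\|^2=\sum_{ij}\sigma_{ij}^2.$$ -/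

import Mathlib

namespace Switch

/-- The capacity region of the `n × n` switch: nonnegative rate matrices all of whose row sums and
column sums are at most `1`. -/
def capacityRegion (n : ℕ) : Set (Fin n → Fin n → ℝ) :=
  {x | (∀ i j, 0 ≤ x i j) ∧ (∀ i, ∑ j, x i j ≤ 1) ∧ (∀ j, ∑ i, x i j ≤ 1)}

/-- The face of the capacity region on which the first `n₁` input ports (rows) and the first `n₂`
output ports (columns) are saturated. -/
def saturatedFace (n n₁ n₂ : ℕ) : Set (Fin n → Fin n → ℝ) :=
  {x | x ∈ capacityRegion n ∧ (∀ i : Fin n, (i : ℕ) < n₁ → ∑ j, x i j = 1) ∧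
    (∀ j : Fin n, (j : ℕ) < n₂ → ∑ i, x i j = 1)}

/-- The smallest entry of a matrix (used for `1 ≤ n`). -/
noncomputable def minEntry {n : ℕ} (x : Fin n → Fin n → ℝ) : ℝ :=
  ⨅ ij : Fin n × Fin n, x ij.1 ij.2

/-- The Euclidean norm of a matrix viewed as a vector with `n ^ 2` components. -/
noncomputable def euclNorm {n : ℕ} (x : Fin n → Fin n → ℝ) : ℝ :=
  Real.sqrt (∑ i, ∑ j, x i j ^ 2)

/-- The largest heavy-traffic parameter considered. When all ports are saturated the positive
constant attached to `ν` is just the smallest entry of `ν`. -/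
noncomputable def epsMax {n : ℕ} (ν k : Fin n → Fin n → ℝ) : ℝ :=
  minEntry ν / (2 * euclNorm k)

/-- Queue length matrices: `q i j` packets wait at input `i` for output `j`. -/
abbrev QueueState (n : ℕ) : Type := Fin n → Fin n → ℕ

/-- The inner product of a queue length matrix with a real weight matrix. -/
def weightedSum {n : ℕ} (α : Fin n → Fin n → ℝ) (q : QueueState n) : ℝ :=
  ∑ i, ∑ j, (q i j : ℝ) * α i j

/-- The joint law of the arrivals in one time slot: the arrivals to different queues are
independent, those to queue `(i, j)` have law `p i j`. -/
noncomputable def arrivalLaw {n : ℕ} (p : Fin n → Fin n → PMF ℕ) : MeasureTheory.Measure (QueueState n) :=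
  MeasureTheory.Measure.pi fun i => MeasureTheory.Measure.pi fun j => (p i j).toMeasure

/-- Mean number of arrivals to queue `(i, j)` in a slot. -/
noncomputable def arrivalMean {n : ℕ} (p : Fin n → Fin n → PMF ℕ) (i j : Fin n) : ℝ :=
  ∫ x, (x : ℝ) ∂(p i j).toMeasure

/-- Variance of the number of arrivals to queue `(i, j)` in a slot. -/
noncomputable def arrivalVar {n : ℕ} (p : Fin n → Fin n → PMF ℕ) (i j : Fin n) : ℝ :=
  ProbabilityTheory.variance (fun x : ℕ => (x : ℝ)) (p i j).toMeasure

/-- The arrivals never exceed `amax` per queue and slot and have mean matrix `lam`. -/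
structure IsArrival {n : ℕ} (amax : ℕ) (lam : Fin n → Fin n → ℝ)
    (p : Fin n → Fin n → PMF ℕ) : Prop where
  le_amax : ∀ i j, ∀ x ∈ (p i j).support, x ≤ amax
  mean_eq : ∀ i j, arrivalMean p i j = lam i j

/-- A version of the MaxWeight algorithm. Maximal schedules are the perfect matchings of inputs to
outputs, i.e. the permutations `s` (input `i` is connected to output `s i`). Given the queue
lengths, a schedule of maximal weight is chosen; ties may be broken in any (possibly random) way
that depends on the current queue lengths only. -/
structure MaxWeight (n : ℕ) where
  schedule : QueueState n → PMF (Equiv.Perm (Fin n))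
  weight_le : ∀ q, ∀ s ∈ (schedule q).support, ∀ t : Equiv.Perm (Fin n),
    ∑ i, q i (t i) ≤ ∑ i, q i (s i)

/-- One slot of the queue dynamics, `q⁺ = max (q + a - s) 0` entrywise (the subtraction of natural
numbers truncates at `0`). -/
def nextQueue {n : ℕ} (q : QueueState n) (s : Equiv.Perm (Fin n)) (a : QueueState n) :
    QueueState n :=
  fun i j => q i j + a i j - (if s i = j then 1 else 0)

/-- The transition kernel of the queue length Markov chain: from `q` draw a schedule by `P` and,
independently, arrivals from `arrivalLaw p`. -/
noncomputable def queueKernel {n : ℕ} (p : Fin n → Fin n → PMF ℕ) (P : MaxWeight n) :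
    ProbabilityTheory.Kernel (QueueState n) (QueueState n) :=
  ProbabilityTheory.Kernel.ofFunOfCountable fun q =>
    ∑ s : Equiv.Perm (Fin n), P.schedule q s • (arrivalLaw p).map (nextQueue q s)

/-- `μ` is a steady-state law of the queue lengths: a probability measure that is invariant under
the queue length chain. -/
def IsSteadyState {n : ℕ} (p : Fin n → Fin n → PMF ℕ) (P : MaxWeight n)
    (μ : MeasureTheory.Measure (QueueState n)) : Prop :=
  MeasureTheory.IsProbabilityMeasure μ ∧ (queueKernel p P).Invariant μ

end Switch

/-! The argument compares q with `collapseCone`, the nonnegative matrices of the form row weight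
plus column weight. Let d = `coneDist` q, z = q - `coneProj` q, m = ν_min, and let Π = `spanProj` be
the orthogonal projection to the span of the cone.

State space collapse. The residual z lies in the polar cone, so its row and column sums are
nonpositive and ν + (m/d) z is still substochastic. MaxWeight does at least as well as this matrix,
which gives d² a drift of order -2md; the perturbation εk costs at most half of it because ε‖k‖ ≤
m/2 (`IsArrival.integral_coneDist_sq_le`). The test function d³ then bounds E[d²] uniformly in ε
(`IsSteadyState.coneDist_sq`).

Drift along the span. ν and every schedule have the same image under Π, so Π(λ - s) = -εΠk whatever
MaxWeight chooses. Zero stationary drift of ⟨q, Πq⟩ therefore says that 2ε E⟨q, Πk⟩ equals (2/n -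
1/n²)‖σ‖² + ε²⟨k, Πk⟩ up to terms with the unused service u. As u is orthogonal to the next state
q⁺, ⟨q⁺, Πu⟩ = -⟨q⁺ - Πq⁺, u⟩, which is controlled by the collapse and by the mean total of u,
namely εn. Young's inequality with weight √ε makes this error O(√ε) (`IsSteadyState.abs_drift_le`).
Multiplying by n/(2ε) gives (1 - 1/(2n))‖σ‖²/ε + o(1/ε). Finally α - nΠk has zero row and column
sums, hence is orthogonal to the cone, so replacing nΠk by α costs only a multiple of E[d]
(`abs_dot_sub_le`).

Integrability. The mere existence of a steady state forces every port load below 1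
(`IsSteadyState.dot_lt_one`); with that slack ‖q‖² has negative drift and ‖q‖ a finite second
moment.

Uniqueness in (a) holds because the empty state is reachable from everywhere through slots without
arrivals; existence is a Foster–Lyapunov argument with tight Cesàro averages. -/

namespace Switch

open MeasureTheory ProbabilityTheory Filter Topology
open scoped ENNReal NNReal

/-! ### Invariant measures of Markov kernels on a countable space, and drift conditions -/

section MarkovChain

variable {X : Type*} [MeasurableSpace X] [DiscreteMeasurableSpace X] [Countable X]
  {κ : Kernel X X} [IsMarkovKernel κ] {μ : Measure X} [IsProbabilityMeasure μ]


theorem lintegral_lintegral_of_invariant {κ : Kernel X X} {μ : Measure X}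
    (h : κ.Invariant μ) (f : X → ℝ≥0∞) : ∫⁻ x, ∫⁻ y, f y ∂κ x ∂μ = ∫⁻ x, f x ∂μ := by
  conv_rhs => rw [← h.def]
  rw [Measure.lintegral_bind κ.aemeasurable Measurable.of_discrete.aemeasurable]

/-- Since `W` need not be integrable, it is truncated: `min W M` is bounded, so its stationary drift
is zero. The drift inequality survives where `W ≤ M`, and elsewhere the truncation is already at its
maximum and cannot increase. Monotone convergence in `M` concludes. -/
theorem lintegral_le_of_drift (h : κ.Invariant μ) {W f : X → ℝ≥0∞} {b : ℝ≥0∞}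
    (hW : ∀ x, W x ≠ ∞) (hd : ∀ x, ∫⁻ y, W y ∂κ x + f x ≤ W x + b) :
    ∫⁻ x, f x ∂μ ≤ b := by
  classical
  have key : ∀ M : ℕ, ∫⁻ x, (if W x ≤ M then f x else 0) ∂μ ≤ b := by
    intro M
    have hfin : ∫⁻ x, min (W x) M ∂μ ≠ ∞ := by
      refine ne_top_of_le_ne_top (b := (M : ℝ≥0∞)) (by simp) ?_
      calc ∫⁻ x, min (W x) M ∂μ ≤ ∫⁻ x, (M : ℝ≥0∞) ∂μ := lintegral_mono fun x => min_le_right _ _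
        _ = M := by simp
    have h1 : ∫⁻ x, min (W x) M ∂μ + ∫⁻ x, (if W x ≤ M then f x else 0) ∂μ
        ≤ ∫⁻ x, min (W x) M ∂μ + b := by
      calc _ = ∫⁻ x, (∫⁻ y, min (W y) M ∂κ x + (if W x ≤ M then f x else 0)) ∂μ := by
            rw [lintegral_add_left Measurable.of_discrete, lintegral_lintegral_of_invariant h]
        _ ≤ ∫⁻ x, (min (W x) M + b) ∂μ := by
            refine lintegral_mono fun x => ?_
            by_cases hx : W x ≤ M
            · simp only [hx, if_true, min_eq_left]
              exact (add_le_add (lintegral_mono fun y => min_le_left _ _) le_rfl).trans (hd x)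
            · simp only [hx, if_false, add_zero]
              rw [min_eq_right (not_le.1 hx).le]
              calc ∫⁻ y, min (W y) M ∂κ x ≤ ∫⁻ y, (M : ℝ≥0∞) ∂κ x :=
                    lintegral_mono fun x => min_le_right _ _
                _ ≤ M + b := by simp
        _ = _ := by rw [lintegral_add_left Measurable.of_discrete]; simp
    exact (ENNReal.add_le_add_iff_left hfin).1 h1
  have hsup : ∀ x, f x = ⨆ M : ℕ, (if W x ≤ M then f x else 0) := by
    intro x
    refine le_antisymm ?_ (iSup_le fun M => by split_ifs <;> simp)
    obtain ⟨M, hM⟩ := ENNReal.exists_nat_gt (hW x)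
    exact le_iSup_of_le M (by simp [hM.le])
  rw [lintegral_congr hsup, lintegral_iSup (fun _ => Measurable.of_discrete)]
  · exact iSup_le key
  · intro M N hMN x
    dsimp only
    split_ifs with h1 h2
    · exact le_rfl
    · exact absurd (h1.trans (by exact_mod_cast hMN)) h2
    · exact zero_le
    · exact le_rfl

theorem integrable_of_drift (h : κ.Invariant μ) {w f : X → ℝ} {b : ℝ}
    (hw : ∀ x, 0 ≤ w x) (hf : ∀ x, 0 ≤ f x) (hb : 0 ≤ b) (hint : ∀ x, Integrable w (κ x))
    (hd : ∀ x, ∫ y, w y ∂κ x + f x ≤ w x + b) :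
    Integrable f μ ∧ ∫ x, f x ∂μ ≤ b := by
  have h1 : ∫⁻ x, ENNReal.ofReal (f x) ∂μ ≤ ENNReal.ofReal b := by
    refine lintegral_le_of_drift h (W := fun x => ENNReal.ofReal (w x)) (by simp) fun x => ?_
    rw [← ofReal_integral_eq_lintegral_ofReal (hint x) (ae_of_all _ hw),
      ← ENNReal.ofReal_add (integral_nonneg hw) (hf x), ← ENNReal.ofReal_add (hw x) hb]
    exact ENNReal.ofReal_le_ofReal (hd x)
  have hi : Integrable f μ := by
    refine ⟨Measurable.of_discrete.aestronglyMeasurable, ?_⟩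
    rw [hasFiniteIntegral_iff_ofReal (ae_of_all _ hf)]
    exact h1.trans_lt ENNReal.ofReal_lt_top
  refine ⟨hi, ?_⟩
  rw [integral_eq_lintegral_of_nonneg_ae (ae_of_all _ hf) hi.1]
  exact ENNReal.toReal_le_of_le_ofReal hb h1

theorem integral_integral_of_invariant {κ : Kernel X X} {μ : Measure X} [SFinite μ] [IsSFiniteKernel κ]
    (h : κ.Invariant μ) {f : X → ℝ} (hf : Integrable f μ) :
    Integrable (fun x => ∫ y, f y ∂κ x) μ ∧ ∫ x, ∫ y, f y ∂κ x ∂μ = ∫ x, f x ∂μ := by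
  have hb : μ.bind κ = μ := h.def
  have hb' : (κ ∘ₖ Kernel.const Unit μ) () = μ := by
    rw [← Measure.comp_eq_comp_const_apply]; exact hb
  have hf' : Integrable f ((κ ∘ₖ Kernel.const Unit μ) ()) := by rwa [hb']
  refine ⟨by simpa using hf'.integral_comp, ?_⟩
  have := Kernel.integral_comp hf'
  rw [hb'] at this
  simpa using this.symm

/-- Second moments from a quadratic drift condition and bounded increments. -/
theorem integrable_sq_of_drift (h : κ.Invariant μ) {d : X → ℝ} {c K B : ℝ} (hc : 0 < c)
    (hK : 0 ≤ K) (hB : 0 ≤ B) (hd : ∀ x, 0 ≤ d x)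
    (hinc : ∀ x, ∀ᵐ y ∂κ x, |d y - d x| ≤ B)
    (hdrift : ∀ x, ∫ y, d y ^ 2 ∂κ x ≤ d x ^ 2 - 2 * c * d x + K) :
    Integrable (fun x => d x ^ 2) μ ∧
      ∫ x, d x ^ 2 ∂μ ≤ ((3 / 2 * (K + B ^ 2)) ^ 2 / (4 * c) + B ^ 3) / (2 * c) := by
  have hbd : ∀ x (m : ℕ), Integrable (fun y => d y ^ m) (κ x) := by
    intro x m
    refine Integrable.of_bound Measurable.of_discrete.aestronglyMeasurable ((d x + B) ^ m) ?_
    filter_upwards [hinc x] with y hy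
    rw [Real.norm_of_nonneg (pow_nonneg (hd y) m)]
    exact pow_le_pow_left₀ (hd y) (by linarith [(abs_le.1 hy).2]) m
  -- The drift of d³ is about (3/2)d times that of d², hence -3c d² plus a linear term; absorbing
  -- the linear term costs c d² and leaves -2c d².
  have key := integrable_of_drift h (w := fun x => d x ^ 3) (f := fun x => 2 * c * d x ^ 2)
    (b := (3 / 2 * (K + B ^ 2)) ^ 2 / (4 * c) + B ^ 3) (fun x => pow_nonneg (hd x) 3)
    (fun x => by positivity) (by positivity) (fun x => hbd x 3) (fun x => by
      have h1 : ∫ y, d y ^ 3 ∂κ x ≤ ∫ y, (3 / 2 * d x * d y ^ 2 +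
          (d x ^ 3 - 3 / 2 * d x ^ 3 + B ^ 2 * (3 / 2 * d x + B))) ∂κ x := by
        refine integral_mono_ae (hbd x 3) (((hbd x 2).const_mul _).add (integrable_const _)) ?_
        filter_upwards [hinc x] with y hy
        -- The cube is written through the increment of the square, so that `hdrift` applies; the
        -- remainder is quadratic in the increment and thus linear in `d x`.
        have e : d y ^ 3 = d x ^ 3 + 3 / 2 * d x * (d y ^ 2 - d x ^ 2)
          + (d y - d x) ^ 2 * (d y + d x / 2) := by ring
        have e2 : (d y - d x) ^ 2 * (d y + d x / 2) ≤ B ^ 2 * (3 / 2 * d x + B) := by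
          refine mul_le_mul (sq_le_sq' (abs_le.1 hy).1 (abs_le.1 hy).2) ?_ ?_ (sq_nonneg _)
          · linarith [(abs_le.1 hy).2]
          · linarith [hd x, hd y]
        linarith
      rw [integral_add ((hbd x 2).const_mul _) (integrable_const _), integral_const_mul] at h1
      simp only [integral_const, probReal_univ, smul_eq_mul, one_mul] at h1
      have h2 : 3 / 2 * d x * ∫ y, d y ^ 2 ∂κ x ≤ 3 / 2 * d x * (d x ^ 2 - 2 * c * d x + K) :=
        mul_le_mul_of_nonneg_left (hdrift x) (by linarith [hd x])
      have h3 : 3 / 2 * (K + B ^ 2) * d x ≤ c * d x ^ 2 + (3 / 2 * (K + B ^ 2)) ^ 2 / (4 * c) := by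
        have : 0 ≤ (2 * c * d x - 3 / 2 * (K + B ^ 2)) ^ 2 / (4 * c) := by positivity
        have e : (2 * c * d x - 3 / 2 * (K + B ^ 2)) ^ 2 / (4 * c)
            = c * d x ^ 2 - 3 / 2 * (K + B ^ 2) * d x + (3 / 2 * (K + B ^ 2)) ^ 2 / (4 * c) := by
          field_simp; ring
        linarith
      nlinarith)
  obtain ⟨k1, k2⟩ := key
  have hi : Integrable (fun x => d x ^ 2) μ := by
    have := k1.const_mul (2 * c)⁻¹
    refine this.congr (ae_of_all _ fun x => ?_)
    field_simp
  refine ⟨hi, ?_⟩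
  rw [integral_const_mul] at k2
  rw [le_div_iff₀ (by positivity)]
  linarith

/-- A function with bounded increments has zero mean drift in steady state. -/
theorem integral_drift_eq_zero (h : κ.Invariant μ) {F : X → ℝ} {B : ℝ} (hB : 0 ≤ B)
    (hF : ∀ x, 0 ≤ F x) (hinc : ∀ x, ∀ᵐ y ∂κ x, |F y - F x| ≤ B) :
    Integrable (fun x => ∫ y, F y ∂κ x - F x) μ ∧ ∫ x, (∫ y, F y ∂κ x - F x) ∂μ = 0 := by
  have hFi : ∀ x, Integrable F (κ x) := by
    intro x
    refine Integrable.of_bound Measurable.of_discrete.aestronglyMeasurable (F x + B) ?_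
    filter_upwards [hinc x] with y hy
    rw [Real.norm_of_nonneg (hF y)]
    linarith [(abs_le.1 hy).2]
  have hmi : ∀ (ρ : Measure X) [IsProbabilityMeasure ρ] (M : ℕ),
      Integrable (fun y => min (F y) M) ρ := by
    intro ρ _ M
    refine Integrable.of_bound Measurable.of_discrete.aestronglyMeasurable (M : ℝ)
      (ae_of_all _ fun y => ?_)
    rw [Real.norm_of_nonneg (le_min (hF y) (Nat.cast_nonneg M))]
    exact min_le_right _ _
  have hbound : ∀ (G : X → ℝ) (x : X), Integrable G (κ x) → (∀ᵐ y ∂κ x, |G y - G x| ≤ B) →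
      |∫ y, G y ∂κ x - G x| ≤ B := by
    intro G x hG hy
    have e : ∫ y, G y ∂κ x - G x = ∫ y, (G y - G x) ∂κ x := by
      rw [integral_sub hG (integrable_const _)]; simp
    rw [e]
    have := norm_integral_le_of_norm_le_const (μ := κ x) (f := fun y => G y - G x) (C := B) hy
    simpa using this
  -- `F` may fail to be integrable, so the cancellation is done for its truncations. Bounded
  -- increments dominate their drifts, and at a fixed state the truncation is inactive once `M ≥ F x
  -- + B`.
  have hg0 : ∀ M : ℕ, ∫ x, (∫ y, min (F y) M ∂κ x - min (F x) M) ∂μ = 0 := by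
    intro M
    obtain ⟨i1, i2⟩ := integral_integral_of_invariant h (hmi μ M)
    rw [integral_sub i1 (hmi μ M), i2, sub_self]
  have hlim : Tendsto (fun M : ℕ => ∫ x, (∫ y, min (F y) M ∂κ x - min (F x) M) ∂μ) atTop
      (𝓝 (∫ x, (∫ y, F y ∂κ x - F x) ∂μ)) := by
    refine tendsto_integral_of_dominated_convergence (fun _ => B)
      (fun M => Measurable.of_discrete.aestronglyMeasurable) (integrable_const _) ?_ ?_
    · intro M
      refine ae_of_all _ fun x => hbound (fun y => min (F y) M) x (hmi _ M) ?_
      filter_upwards [hinc x] with y hy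
      exact (abs_min_sub_min_le_max _ _ _ _).trans (max_le hy (by simpa using hB))
    · refine ae_of_all _ fun x => ?_
      obtain ⟨M₀, hM₀⟩ := exists_nat_ge (F x + B)
      refine tendsto_const_nhds.congr' ?_
      filter_upwards [eventually_ge_atTop M₀] with M hM
      have hM' : F x + B ≤ M := hM₀.trans (by exact_mod_cast hM)
      rw [min_eq_left (by linarith)]
      congr 1
      refine integral_congr_ae ?_
      filter_upwards [hinc x] with y hy
      rw [min_eq_left (by linarith [(abs_le.1 hy).2])]
  refine ⟨?_, ?_⟩
  · exact Integrable.of_bound Measurable.of_discrete.aestronglyMeasurable B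
      (ae_of_all _ fun x => hbound F x (hFi x) (hinc x))
  · simp_rw [hg0] at hlim
    exact (tendsto_nhds_unique hlim tendsto_const_nhds)

/-- Mass at `x` would flow in one step to a state of lower rank, which is null by induction;
invariance rules this out. -/
theorem eq_zero_of_invariant_of_accessible {m : Measure X} (h : κ.Invariant m) {x₀ : X}
    (rank : X → ℕ) (hacc : ∀ x, x ≠ x₀ → ∃ y, rank y < rank x ∧ κ x {y} ≠ 0)
    (h0 : m {x₀} = 0) : m = 0 := by
  have key : ∀ r x, rank x = r → m {x} = 0 := by
    intro r
    induction r using Nat.strong_induction_on with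
    | _ r ih =>
      intro x hx
      by_cases hx0 : x = x₀
      · rw [hx0, h0]
      obtain ⟨y, hy, hκ⟩ := hacc x hx0
      have hy0 : m {y} = 0 := ih _ (hx ▸ hy) y rfl
      rw [← h.def, Measure.bind_apply (measurableSet_singleton y) κ.aemeasurable,
        lintegral_eq_zero_iff Measurable.of_discrete] at hy0
      by_contra hne
      exact hκ ((ae_iff_of_countable.1 hy0) x hne)
  exact Measure.ext_of_singleton fun x => by simp [key _ x rfl]

/-- The common part `μ₁ ⊓ μ₂` is subinvariant, hence invariant because the kernel preserves total
mass. At `x₀` it carries the smaller of the two masses, so one of the invariant differences does not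
charge `x₀` and vanishes. That measure then lies below the other, and both have mass one. -/
theorem eq_of_invariant_of_accessible {μ₁ μ₂ : Measure X} [IsProbabilityMeasure μ₁]
    [IsProbabilityMeasure μ₂] (h₁ : κ.Invariant μ₁) (h₂ : κ.Invariant μ₂) {x₀ : X}
    (rank : X → ℕ) (hacc : ∀ x, x ≠ x₀ → ∃ y, rank y < rank x ∧ κ x {y} ≠ 0) : μ₁ = μ₂ := by
  set m : Measure X := μ₁ ⊓ μ₂ with hm
  have hm1 : m ≤ μ₁ := inf_le_left
  have hm2 : m ≤ μ₂ := inf_le_right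
  have : IsFiniteMeasure m := isFiniteMeasure_of_le μ₁ hm1
  have mono : ∀ {ρ : Measure X}, m ≤ ρ → κ.Invariant ρ → m.bind κ ≤ ρ := by
    intro ρ hρ hinv
    rw [← hinv.def]
    refine Measure.le_iff.2 fun s hs => ?_
    rw [Measure.bind_apply hs κ.aemeasurable, Measure.bind_apply hs κ.aemeasurable]
    exact lintegral_mono' hρ le_rfl
  have hle : m.bind κ ≤ m := le_inf (mono hm1 h₁) (mono hm2 h₂)
  have huniv : (m.bind κ) Set.univ = m Set.univ := by
    rw [Measure.bind_apply MeasurableSet.univ κ.aemeasurable]; simp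
  have hminv : m.bind κ = m := by
    have : IsFiniteMeasure (m.bind κ) := isFiniteMeasure_of_le m hle
    have e := Measure.sub_add_cancel_of_le hle
    have : m - m.bind κ = 0 := by
      rw [← Measure.measure_univ_eq_zero]
      have e2 : (m - m.bind κ) Set.univ + (m.bind κ) Set.univ = 0 + (m.bind κ) Set.univ := by
        rw [← Measure.add_apply, e, zero_add, huniv]
      exact (ENNReal.add_left_inj (measure_ne_top _ _)).1 e2
    rw [this, zero_add] at e
    exact e
  have hsub : ∀ {ρ : Measure X} [IsProbabilityMeasure ρ], m ≤ ρ → κ.Invariant ρ →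
      ρ {x₀} = m {x₀} → ρ = m := by
    intro ρ _ hρ hinv hx
    have e := Measure.sub_add_cancel_of_le hρ
    have hi : κ.Invariant (ρ - m) := by
      have e1 : κ ∘ₘ (ρ - m + m) = κ ∘ₘ (ρ - m) + κ ∘ₘ m := Measure.comp_add
      rw [e] at e1
      have e2 : ρ = (ρ - m).bind κ + m := by
        conv_lhs => rw [← hinv.def]
        rw [e1, hminv]
      refine Measure.ext_of_singleton fun x => ?_
      have e3 : (ρ - m) {x} + m {x} = ((ρ - m).bind κ) {x} + m {x} := by
        rw [← Measure.add_apply, ← Measure.add_apply, e, ← e2]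
      exact ((ENNReal.add_left_inj (measure_ne_top _ _)).1 e3).symm
    have h0 : (ρ - m) {x₀} = 0 := by
      have : (ρ - m) {x₀} + m {x₀} = 0 + m {x₀} := by rw [← Measure.add_apply, e, zero_add, hx]
      exact (ENNReal.add_left_inj (measure_ne_top _ _)).1 this
    rw [eq_zero_of_invariant_of_accessible hi rank hacc h0, zero_add] at e
    exact e.symm
  have hdirac : ∀ {ρ : Measure X} {c : ℝ≥0∞}, c ≤ ρ {x₀} → c • Measure.dirac x₀ ≤ ρ := by
    intro ρ c hc
    refine Measure.le_iff.2 fun s hs => ?_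
    rw [Measure.smul_apply, Measure.dirac_apply' _ hs, smul_eq_mul]
    by_cases hx : x₀ ∈ s
    · simpa [hx] using hc.trans (measure_mono (Set.singleton_subset_iff.2 hx))
    · simp [hx]
  have hx0 : min (μ₁ {x₀}) (μ₂ {x₀}) ≤ m {x₀} := by
    have : min (μ₁ {x₀}) (μ₂ {x₀}) • Measure.dirac x₀ ≤ m :=
      le_inf (hdirac (min_le_left _ _)) (hdirac (min_le_right _ _))
    simpa using this {x₀}
  have heq : ∀ {ρ ρ' : Measure X} [IsProbabilityMeasure ρ] [IsProbabilityMeasure ρ'],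
      ρ = m → m ≤ ρ' → ρ = ρ' := by
    intro ρ ρ' _ _ h1 h2
    exact Measure.eq_of_le_of_isProbabilityMeasure (h1.trans_le h2)
  rcases min_le_iff.1 hx0 with hx | hx
  · exact heq (hsub hm1 h₁ (le_antisymm hx (hm1 _))) hm2
  · exact (heq (hsub hm2 h₂ (le_antisymm hx (hm2 _))) hm1).symm

/-- Existence of an invariant probability measure under a Foster–Lyapunov drift condition. -/
theorem exists_invariant_of_drift [TopologicalSpace X] [DiscreteTopology X] [BorelSpace X]
    {V f : X → ℝ≥0∞} {b : ℝ≥0∞} (x₀ : X) (hV : V x₀ ≠ ∞) (hb : b ≠ ∞)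
    (hf : ∀ R : ℕ, {x | f x < R}.Finite)
    (hd : ∀ x, ∫⁻ y, V y ∂κ x + f x ≤ V x + b) :
    ∃ μ : Measure X, IsProbabilityMeasure μ ∧ κ.Invariant μ := by
  classical
  -- `m N` is the law of the chain after `N` steps from `x₀`; the drift inequality is telescoped
  -- along it.
  let m : ℕ → Measure X := fun N => Nat.rec (Measure.dirac x₀) (fun _ ρ => ρ.bind κ) N
  have hm0 : m 0 = Measure.dirac x₀ := rfl
  have hms : ∀ N, m (N + 1) = (m N).bind κ := fun N => rfl
  have hmp : ∀ N, IsProbabilityMeasure (m N) := by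
    intro N
    induction N with
    | zero => rw [hm0]; infer_instance
    | succ N ih =>
      refine ⟨?_⟩
      rw [hms, Measure.bind_apply MeasurableSet.univ κ.aemeasurable]
      simpa using ih.measure_univ
  clear_value m
  have hsum : ∀ N, ∫⁻ x, V x ∂(m N) + ∑ k ∈ Finset.range N, ∫⁻ x, f x ∂(m k) ≤ V x₀ + N * b := by
    intro N
    induction N with
    | zero => simp [hm0]
    | succ N ih =>
      have h1 : ∫⁻ x, V x ∂(m (N + 1)) + ∫⁻ x, f x ∂(m N) ≤ ∫⁻ x, V x ∂(m N) + b := by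
        rw [hms, Measure.lintegral_bind κ.aemeasurable Measurable.of_discrete.aemeasurable,
          ← lintegral_add_left Measurable.of_discrete]
        refine (lintegral_mono hd).trans ?_
        rw [lintegral_add_left Measurable.of_discrete]
        simp
      rw [Finset.sum_range_succ]
      calc _ = (∫⁻ x, V x ∂(m (N + 1)) + ∫⁻ x, f x ∂(m N))
            + ∑ k ∈ Finset.range N, ∫⁻ x, f x ∂(m k) := by ring
        _ ≤ (∫⁻ x, V x ∂(m N) + b) + ∑ k ∈ Finset.range N, ∫⁻ x, f x ∂(m k) := by gcongr
        _ = (∫⁻ x, V x ∂(m N) + ∑ k ∈ Finset.range N, ∫⁻ x, f x ∂(m k)) + b := by ring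
        _ ≤ (V x₀ + N * b) + b := by gcongr
        _ = _ := by push_cast; ring
  -- The Cesàro averages have uniformly bounded `f`-integral. Since the sublevel sets of `f` are
  -- finite, Markov's inequality makes them tight.
  set A : ℕ → Measure X := fun N => ((N : ℝ≥0∞) + 1)⁻¹ • ∑ k ∈ Finset.range (N + 1), m k
  have hN0 : ∀ N : ℕ, (N : ℝ≥0∞) + 1 ≠ 0 := fun N => by simp
  have hNt : ∀ N : ℕ, (N : ℝ≥0∞) + 1 ≠ ∞ := fun N => by simp
  have hAint : ∀ N (g : X → ℝ≥0∞), ∫⁻ x, g x ∂(A N)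
      = ((N : ℝ≥0∞) + 1)⁻¹ * ∑ k ∈ Finset.range (N + 1), ∫⁻ x, g x ∂(m k) := by
    intro N g
    simp only [A]
    rw [lintegral_smul_measure, lintegral_finsetSum_measure, smul_eq_mul]
  have hAp : ∀ N, IsProbabilityMeasure (A N) := by
    intro N
    refine ⟨?_⟩
    have := hAint N (fun _ => 1)
    simp only [lintegral_one, (hmp _).measure_univ, Finset.sum_const, Finset.card_range,
      nsmul_eq_mul, mul_one] at this
    rw [this]
    push_cast
    exact ENNReal.inv_mul_cancel (hN0 N) (hNt N)
  have hAf : ∀ N, ∫⁻ x, f x ∂(A N) ≤ V x₀ + b := by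
    intro N
    rw [hAint]
    have h1 := le_of_add_le_right (hsum (N + 1))
    calc _ ≤ ((N : ℝ≥0∞) + 1)⁻¹ * (((N : ℝ≥0∞) + 1) * (V x₀ + b)) := by
          gcongr
          refine h1.trans ?_
          push_cast
          rw [mul_add]
          gcongr
          exact le_mul_of_one_le_left zero_le le_add_self
      _ = V x₀ + b := by
          rw [← mul_assoc, ENNReal.inv_mul_cancel (hN0 N) (hNt N), one_mul]
  let A' : ℕ → ProbabilityMeasure X := fun N => ⟨A N, hAp N⟩
  let S : Set (ProbabilityMeasure X) := Set.range A'
  have htight : IsTightMeasureSet {((ρ : ProbabilityMeasure X) : Measure X) | ρ ∈ S} := by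
    rw [isTightMeasureSet_iff_exists_isCompact_measure_compl_le]
    intro ε hε
    obtain ⟨R, hR⟩ : ∃ R : ℕ, (V x₀ + b) / ε < R :=
      ENNReal.exists_nat_gt (ENNReal.div_ne_top (ENNReal.add_ne_top.2 ⟨hV, hb⟩) hε.ne')
    refine ⟨{x | f x < R}, (hf R).isCompact, ?_⟩
    rintro _ ⟨_, ⟨N, rfl⟩, rfl⟩
    have hRpos : (R : ℝ≥0∞) ≠ 0 := (lt_of_le_of_lt zero_le hR).ne'
    have hset : {x | f x < R}ᶜ = {x | (R : ℝ≥0∞) ≤ f x} := by ext; simp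
    have h1 := mul_meas_ge_le_lintegral (μ := A N) (f := f) Measurable.of_discrete (R : ℝ≥0∞)
    have h2 : (A N) {x | (R : ℝ≥0∞) ≤ f x} ≤ ε := by
      by_cases hεt : ε = ∞
      · rw [hεt]; exact le_top
      have h3 : (R : ℝ≥0∞) * (A N) {x | (R : ℝ≥0∞) ≤ f x} ≤ R * ε := by
        refine (h1.trans (hAf N)).trans ?_
        exact (ENNReal.div_le_iff hε.ne' hεt).1 hR.le
      exact (ENNReal.mul_le_mul_iff_right hRpos (ENNReal.natCast_ne_top R)).1 h3
    rw [hset]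
    exact h2
  have hcomp := isCompact_closure_of_isTightMeasureSet htight
  -- A limit along a nonprincipal ultrafilter replaces the choice of a convergent subsequence.
  obtain ⟨π, -, hπ⟩ := isCompact_iff_ultrafilter_le_nhds.1 hcomp
    ((hyperfilter ℕ).map A') (by
      rw [le_principal_iff]
      exact Filter.Eventually.of_forall (f := hyperfilter ℕ) (p := fun N => A' N ∈ closure S) fun N =>
        subset_closure ⟨N, rfl⟩)
  have hT : Tendsto (A') (hyperfilter ℕ) (𝓝 π) := hπ
  rw [ProbabilityMeasure.tendsto_iff_forall_lintegral_tendsto] at hT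
  have hT' : ∀ g : X → ℝ≥0∞, (∀ x, g x ≤ 1) →
      Tendsto (fun N => ∫⁻ x, g x ∂(A N)) (hyperfilter ℕ) (𝓝 (∫⁻ x, g x ∂(π : Measure X))) := by
    intro g hg
    have hgt : ∀ x, g x ≠ ∞ := fun x => ne_top_of_le_ne_top ENNReal.one_ne_top (hg x)
    have hdist : ∀ x y, dist (g x).toNNReal (g y).toNNReal ≤ 1 := by
      intro x y
      have hx : (g x).toReal ≤ 1 := ENNReal.toReal_le_of_le_ofReal zero_le_one (by simpa using hg x)
      have hy : (g y).toReal ≤ 1 := ENNReal.toReal_le_of_le_ofReal zero_le_one (by simpa using hg y)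
      rw [NNReal.dist_eq]
      change |(g x).toReal - (g y).toReal| ≤ 1
      rw [abs_le]
      constructor <;> linarith [ENNReal.toReal_nonneg (a := g x), ENNReal.toReal_nonneg (a := g y)]
    have := hT (BoundedContinuousFunction.mkOfBound ⟨fun x => (g x).toNNReal, continuous_of_discreteTopology⟩ 1 hdist)
    simp only [BoundedContinuousFunction.mkOfBound_coe, ContinuousMap.coe_mk,
      ENNReal.coe_toNNReal (hgt _)] at this
    exact this
  refine ⟨π, inferInstance, ?_⟩
  refine Measure.ext_of_singleton fun y => ?_
  have hs := measurableSet_singleton y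
  -- Applying the kernel shifts the average by one step, so only two boundary terms of size at most
  -- 1/(N+1) change. Both sides pass to the limit since every function on a discrete space is
  -- continuous.
  have hid : ∀ N, ∫⁻ x, κ x {y} ∂(A N) + ((N : ℝ≥0∞) + 1)⁻¹ * m 0 {y}
      = (A N) {y} + ((N : ℝ≥0∞) + 1)⁻¹ * m (N + 1) {y} := by
    intro N
    have h1 : (A N) {y} = ((N : ℝ≥0∞) + 1)⁻¹ * ∑ k ∈ Finset.range (N + 1), m k {y} := by
      have := hAint N (({y} : Set X).indicator 1)
      simpa only [lintegral_indicator_one hs] using this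
    rw [h1, hAint, ← mul_add, ← mul_add]
    congr 1
    have h2 : ∀ k, ∫⁻ x, κ x {y} ∂(m k) = m (k + 1) {y} := fun k => by
      rw [hms, Measure.bind_apply hs κ.aemeasurable]
    simp_rw [h2]
    rw [← Finset.sum_range_succ' (fun k => m k {y}), Finset.sum_range_succ]
  have hvanish : ∀ c : ℕ → ℝ≥0∞, (∀ N, c N ≤ 1) →
      Tendsto (fun N : ℕ => ((N : ℝ≥0∞) + 1)⁻¹ * c N) (hyperfilter ℕ) (𝓝 0) := by
    intro c hc
    have h1 : Tendsto (fun N : ℕ => ((N : ℝ≥0∞) + 1)⁻¹) atTop (𝓝 0) := by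
      have := (tendsto_add_atTop_iff_nat 1).2 ENNReal.tendsto_inv_nat_nhds_zero
      simpa using this
    have h2 : Tendsto (fun N : ℕ => ((N : ℝ≥0∞) + 1)⁻¹) (hyperfilter ℕ) (𝓝 0) :=
      h1.mono_left Nat.hyperfilter_le_atTop
    refine tendsto_of_tendsto_of_tendsto_of_le_of_le tendsto_const_nhds h2 (fun _ => zero_le) ?_
    intro N
    exact mul_le_of_le_one_right zero_le (hc N)
  have hL := (hT' (fun x => κ x {y}) fun x => prob_le_one).add
    (hvanish (fun _ => m 0 {y}) fun _ => prob_le_one)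
  have hR := (hT' (({y} : Set X).indicator 1) fun x => Set.indicator_le_self' (by simp) x).add
    (hvanish (fun N => m (N + 1) {y}) fun _ => prob_le_one)
  simp only [lintegral_indicator_one hs] at hR
  have := tendsto_nhds_unique (hL.congr hid) hR
  rw [add_zero, add_zero] at this
  rw [Measure.bind_apply hs κ.aemeasurable, this]

end MarkovChain

/-! ### The queue kernel and moments of the arrivals -/

section Kernel

variable {n : ℕ}

/-- The entrywise inner product of two matrices. -/
def dot (x y : Fin n → Fin n → ℝ) : ℝ := ∑ i, ∑ j, x i j * y i j

/-- A queue length matrix with real entries. -/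
def toReal (q : QueueState n) : Fin n → Fin n → ℝ := fun i j => (q i j : ℝ)

/-- The permutation matrix of a schedule. -/
def schedMat (s : Equiv.Perm (Fin n)) : Fin n → Fin n → ℝ := fun i j => if s i = j then 1 else 0

theorem dot_comm (x y : Fin n → Fin n → ℝ) : dot x y = dot y x := by
  simp only [dot, mul_comm]

theorem dot_add (x y z : Fin n → Fin n → ℝ) : dot x (y + z) = dot x y + dot x z := by
  simp [dot, mul_add, Finset.sum_add_distrib]

theorem dot_sub (x y z : Fin n → Fin n → ℝ) : dot x (y - z) = dot x y - dot x z := by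
  simp [dot, mul_sub, Finset.sum_sub_distrib]

theorem dot_smul (c : ℝ) (x y : Fin n → Fin n → ℝ) : dot x (c • y) = c * dot x y := by
  simp only [dot, Pi.smul_apply, smul_eq_mul, Finset.mul_sum]
  exact Finset.sum_congr rfl fun i _ => Finset.sum_congr rfl fun j _ => by ring

theorem add_dot (x y z : Fin n → Fin n → ℝ) : dot (x + y) z = dot x z + dot y z := by
  rw [dot_comm, dot_add, dot_comm z x, dot_comm z y]

theorem sub_dot (x y z : Fin n → Fin n → ℝ) : dot (x - y) z = dot x z - dot y z := by
  rw [dot_comm, dot_sub, dot_comm z x, dot_comm z y]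

theorem dot_self_nonneg (x : Fin n → Fin n → ℝ) : 0 ≤ dot x x :=
  Finset.sum_nonneg fun _ _ => Finset.sum_nonneg fun _ _ => mul_self_nonneg _

instance isProbabilityMeasure_arrivalLaw (p : Fin n → Fin n → PMF ℕ) :
    IsProbabilityMeasure (arrivalLaw p) := by
  unfold arrivalLaw; infer_instance

theorem queueKernel_apply (p : Fin n → Fin n → PMF ℕ) (P : MaxWeight n) (q : QueueState n) :
    queueKernel p P q
      = ∑ s : Equiv.Perm (Fin n), P.schedule q s • (arrivalLaw p).map (nextQueue q s) := rfl

theorem sum_schedule (P : MaxWeight n) (q : QueueState n) : ∑ s, P.schedule q s = 1 := by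
  rw [← tsum_fintype (L := SummationFilter.unconditional _)]; exact (P.schedule q).tsum_coe

instance isMarkovKernel_queueKernel (p : Fin n → Fin n → PMF ℕ) (P : MaxWeight n) :
    IsMarkovKernel (queueKernel p P) := by
  refine ⟨fun q => ⟨?_⟩⟩
  rw [queueKernel_apply, Measure.finsetSum_apply]
  have : ∀ s, ((arrivalLaw p).map (nextQueue q s)) Set.univ = 1 := fun s => by
    rw [Measure.map_apply Measurable.of_discrete MeasurableSet.univ]; simp
  simp only [Measure.smul_apply, this, smul_eq_mul, mul_one]
  exact sum_schedule P q

variable {p : Fin n → Fin n → PMF ℕ} {amax : ℕ} {lam : Fin n → Fin n → ℝ}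

theorem IsArrival.ae_le (h : IsArrival amax lam p) : ∀ᵐ a ∂arrivalLaw p, ∀ i j, a i j ≤ amax := by
  rw [ae_all_iff]; intro i
  rw [ae_all_iff]; intro j
  have h1 : ∀ᵐ x ∂(p i j).toMeasure, x ≤ amax := by
    rw [ae_iff, PMF.toMeasure_apply_eq_zero_iff _ (MeasurableSet.of_discrete)]
    rw [Set.disjoint_left]
    intro x hx hx'
    exact hx' (h.le_amax i j x hx)
  have h2 : ∀ᵐ y ∂(Measure.pi fun j => (p i j).toMeasure), y j ≤ amax :=
    (measurePreserving_eval (fun j => (p i j).toMeasure) j).quasiMeasurePreserving.ae h1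
  exact (measurePreserving_eval (fun i => Measure.pi fun j => (p i j).toMeasure)
    i).quasiMeasurePreserving.ae h2

theorem IsArrival.memLp_entry (h : IsArrival amax lam p) (i j : Fin n) (f : ℕ → ℝ) :
    MemLp f 2 (p i j).toMeasure := by
  have h1 : ∀ᵐ x ∂(p i j).toMeasure, x ≤ amax := by
    rw [ae_iff, PMF.toMeasure_apply_eq_zero_iff _ (MeasurableSet.of_discrete)]
    rw [Set.disjoint_left]
    intro x hx hx'
    exact hx' (h.le_amax i j x hx)
  refine MemLp.of_bound Measurable.of_discrete.aestronglyMeasurable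
    (∑ x ∈ Finset.range (amax + 1), ‖f x‖) ?_
  filter_upwards [h1] with x hx
  exact Finset.single_le_sum (f := fun x => ‖f x‖) (fun _ _ => norm_nonneg _)
    (Finset.mem_range.2 (Nat.lt_succ_of_le hx))

/-- Bounded arrivals live on a finite set of matrices, so no growth condition on `f` is needed. -/
theorem IsArrival.integrable (h : IsArrival amax lam p) (f : QueueState n → ℝ) :
    Integrable f (arrivalLaw p) := by
  have hfin : ({a : QueueState n | ∀ i j, a i j ≤ amax}).Finite := by
    have : {a : QueueState n | ∀ i j, a i j ≤ amax} = Set.Iic (fun _ _ => amax) := by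
      ext a; simp [Pi.le_def]
    rw [this]; exact Set.finite_Iic _
  refine Integrable.of_bound Measurable.of_discrete.aestronglyMeasurable
    (∑ a ∈ hfin.toFinset, ‖f a‖) ?_
  filter_upwards [h.ae_le] with a ha
  exact Finset.single_le_sum (f := fun a => ‖f a‖) (fun _ _ => norm_nonneg _)
    (hfin.mem_toFinset.2 ha)

theorem IsArrival.integrable_map (h : IsArrival amax lam p) (q : QueueState n)
    (s : Equiv.Perm (Fin n)) (f : QueueState n → ℝ) :
    Integrable f ((arrivalLaw p).map (nextQueue q s)) := by
  rw [integrable_map_measure Measurable.of_discrete.aestronglyMeasurable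
    Measurable.of_discrete.aemeasurable]
  exact h.integrable _

theorem IsArrival.integrable_queueKernel (h : IsArrival amax lam p) (P : MaxWeight n)
    (q : QueueState n) (f : QueueState n → ℝ) : Integrable f (queueKernel p P q) := by
  rw [queueKernel_apply, integrable_finsetSum_measure]
  exact fun s _ => (h.integrable_map q s f).smul_measure ((P.schedule q).apply_ne_top s)

theorem IsArrival.integral_queueKernel (h : IsArrival amax lam p) (P : MaxWeight n)
    (q : QueueState n) (f : QueueState n → ℝ) :
    ∫ y, f y ∂queueKernel p P q
      = ∑ s, (P.schedule q s).toReal * ∫ a, f (nextQueue q s a) ∂arrivalLaw p := by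
  rw [queueKernel_apply, integral_finsetSum_measure
    (fun s _ => (h.integrable_map q s f).smul_measure ((P.schedule q).apply_ne_top s))]
  refine Finset.sum_congr rfl fun s _ => ?_
  rw [integral_smul_measure, integral_map Measurable.of_discrete.aemeasurable
    Measurable.of_discrete.aestronglyMeasurable, smul_eq_mul]

/-- Only schedules of positive probability matter, which is where the MaxWeight property is
available. -/
theorem IsArrival.integral_queueKernel_le (h : IsArrival amax lam p) (P : MaxWeight n)
    (q : QueueState n) (f : QueueState n → ℝ) {C : ℝ}
    (hf : ∀ s ∈ (P.schedule q).support, ∫ a, f (nextQueue q s a) ∂arrivalLaw p ≤ C) :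
    ∫ y, f y ∂queueKernel p P q ≤ C := by
  rw [h.integral_queueKernel]
  calc _ ≤ ∑ s, (P.schedule q s).toReal * C := by
        refine Finset.sum_le_sum fun s _ => ?_
        by_cases hs : s ∈ (P.schedule q).support
        · exact mul_le_mul_of_nonneg_left (hf s hs) ENNReal.toReal_nonneg
        · rw [PMF.mem_support_iff, not_not] at hs
          simp [hs]
    _ = C := by
        rw [← Finset.sum_mul, ← ENNReal.toReal_sum fun s _ => (P.schedule q).apply_ne_top s,
          sum_schedule]
        simp

theorem IsArrival.ae_queueKernel (h : IsArrival amax lam p) (P : MaxWeight n)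
    (q : QueueState n) {S : QueueState n → Prop}
    (hS : ∀ s a, (∀ i j, a i j ≤ amax) → S (nextQueue q s a)) :
    ∀ᵐ y ∂queueKernel p P q, S y := by
  rw [ae_iff, queueKernel_apply, Measure.finsetSum_apply]
  refine Finset.sum_eq_zero fun s _ => ?_
  rw [Measure.smul_apply, Measure.map_apply Measurable.of_discrete MeasurableSet.of_discrete]
  have : (arrivalLaw p) (nextQueue q s ⁻¹' {y | ¬ S y}) = 0 := by
    have h1 := h.ae_le
    rw [ae_iff] at h1
    refine measure_mono_null (fun a ha hle => ha (hS s a hle)) h1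
  rw [this, smul_zero]

theorem integral_arrivalLaw_entry (p : Fin n → Fin n → PMF ℕ) (i j : Fin n) (f : ℕ → ℝ) :
    ∫ a, f (a i j) ∂arrivalLaw p = ∫ x, f x ∂(p i j).toMeasure := by
  unfold arrivalLaw
  rw [integral_comp_eval (μ := fun i => Measure.pi fun j => (p i j).toMeasure) (i := i)
    (f := fun y => f (y j)) Measurable.of_discrete.aestronglyMeasurable,
    integral_comp_eval (μ := fun j => (p i j).toMeasure) (i := j)
    (f := f) Measurable.of_discrete.aestronglyMeasurable]

theorem IsArrival.integral_dot (h : IsArrival amax lam p) (c : Fin n → Fin n → ℝ) :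
    ∫ a, dot c (toReal a) ∂arrivalLaw p = dot c lam := by
  unfold dot
  rw [integral_finsetSum _ fun i _ => h.integrable _]
  refine Finset.sum_congr rfl fun i _ => ?_
  rw [integral_finsetSum _ fun j _ => h.integrable _]
  refine Finset.sum_congr rfl fun j _ => ?_
  rw [integral_const_mul, ← h.mean_eq i j]
  exact congrArg _ (integral_arrivalLaw_entry p i j fun x => (x : ℝ))

/-- This is the variance of a linear form in independent entries; independence is used once across
rows and once within each row. -/
theorem IsArrival.integral_dot_sub_sq (h : IsArrival amax lam p) (c : Fin n → Fin n → ℝ) :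
    ∫ a, dot c (toReal a - lam) ^ 2 ∂arrivalLaw p = ∑ i, ∑ j, c i j ^ 2 * arrivalVar p i j := by
  have h1 : ∫ a, dot c (toReal a - lam) ^ 2 ∂arrivalLaw p
      = variance (fun a => dot c (toReal a)) (arrivalLaw p) := by
    rw [variance_eq_integral Measurable.of_discrete.aemeasurable, h.integral_dot]
    simp only [dot_sub]
  rw [h1]
  have e1 : (fun a : QueueState n => dot c (toReal a))
      = ∑ i, fun a : QueueState n => (fun y : Fin n → ℕ => ∑ j, c i j * (y j : ℝ)) (a i) := by
    ext a; simp [dot, toReal]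
  have hm : ∀ i j, MemLp (fun x : ℕ => c i j * (x : ℝ)) 2 (p i j).toMeasure :=
    fun i j => h.memLp_entry i j _
  have e2 : ∀ i, (fun y : Fin n → ℕ => ∑ j, c i j * (y j : ℝ))
      = ∑ j, fun y : Fin n → ℕ => (fun x : ℕ => c i j * (x : ℝ)) (y j) := by
    intro i; ext y; simp
  have hm2 : ∀ i, MemLp (fun y : Fin n → ℕ => ∑ j, c i j * (y j : ℝ)) 2
      (Measure.pi fun j => (p i j).toMeasure) := by
    intro i
    refine memLp_finsetSum _ fun j _ => ?_
    exact (hm i j).comp_measurePreserving (measurePreserving_eval _ j)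
  rw [e1]
  unfold arrivalLaw
  rw [variance_sum_pi hm2]
  refine Finset.sum_congr rfl fun i _ => ?_
  rw [e2, variance_sum_pi (hm i)]
  refine Finset.sum_congr rfl fun j _ => ?_
  rw [variance_const_mul]
  rfl

/-- An integer variable that never vanishes has mean at least one. -/
theorem IsArrival.apply_zero_ne_zero (h : IsArrival amax lam p) {i j : Fin n}
    (hlt : lam i j < 1) : p i j 0 ≠ 0 := by
  intro h0
  have h1 : ∀ᵐ x ∂(p i j).toMeasure, (1 : ℝ) ≤ ((x : ℕ) : ℝ) := by
    rw [ae_iff, PMF.toMeasure_apply_eq_zero_iff _ (MeasurableSet.of_discrete), Set.disjoint_left]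
    intro x hx hx'
    have : x = 0 := by
      by_contra hne
      exact hx' (by exact_mod_cast Nat.one_le_iff_ne_zero.2 hne)
    exact hx (this ▸ h0)
  have h2 := integral_mono_ae (integrable_const (1 : ℝ))
    ((h.memLp_entry i j fun x => (x : ℝ)).integrable one_le_two) h1
  have h3 := h.mean_eq i j
  simp only [integral_const, probReal_univ, smul_eq_mul, mul_one] at h2
  rw [arrivalMean] at h3
  linarith

theorem IsArrival.arrivalLaw_zero_ne_zero (h : IsArrival amax lam p)
    (hlt : ∀ i j, lam i j < 1) : arrivalLaw p {0} ≠ 0 := by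
  have e : ({0} : Set (QueueState n)) = {fun _ _ => 0} := rfl
  unfold arrivalLaw
  rw [e, Measure.pi_singleton, Finset.prod_ne_zero_iff]
  intro i _
  rw [Measure.pi_singleton, Finset.prod_ne_zero_iff]
  intro j _
  rw [PMF.toMeasure_apply_singleton _ _ (measurableSet_singleton _)]
  exact h.apply_zero_ne_zero (hlt i j)

theorem IsArrival.mean_nonneg (h : IsArrival amax lam p) (i j : Fin n) : 0 ≤ lam i j := by
  rw [← h.mean_eq]; exact integral_nonneg fun x => Nat.cast_nonneg x

theorem queueKernel_nextQueue_ne_zero (P : MaxWeight n) {q : QueueState n}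
    {s : Equiv.Perm (Fin n)} (hs : s ∈ (P.schedule q).support) {a : QueueState n}
    (ha : arrivalLaw p {a} ≠ 0) : queueKernel p P q {nextQueue q s a} ≠ 0 := by
  rw [queueKernel_apply, Measure.finsetSum_apply]
  intro h0
  have h1 := (Finset.sum_eq_zero_iff.1 h0) s (Finset.mem_univ s)
  rw [Measure.smul_apply, Measure.map_apply Measurable.of_discrete MeasurableSet.of_discrete,
    smul_eq_mul, mul_eq_zero] at h1
  rcases h1 with h1 | h1
  · exact hs h1
  · exact ha (measure_mono_null (by simp) h1)

end Kernel

/-! ### Maximal weight schedules, the collapse cone and unused service -/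

section Geometry

variable {n : ℕ}

/-- The matrix as a vector of the Euclidean space of dimension `n ^ 2`. -/
noncomputable def vec (x : Fin n → Fin n → ℝ) : EuclideanSpace ℝ (Fin n × Fin n) :=
  WithLp.toLp 2 fun ij => x ij.1 ij.2

theorem vec_add (x y : Fin n → Fin n → ℝ) : vec (x + y) = vec x + vec y := rfl

theorem vec_sub (x y : Fin n → Fin n → ℝ) : vec (x - y) = vec x - vec y := rfl

theorem inner_vec (x y : Fin n → Fin n → ℝ) : inner ℝ (vec x) (vec y) = dot x y := by
  simp [vec, PiLp.inner_apply, dot, Fintype.sum_prod_type, mul_comm]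

theorem norm_vec (x : Fin n → Fin n → ℝ) : ‖vec x‖ = euclNorm x := by
  simp [vec, EuclideanSpace.norm_eq, euclNorm, Fintype.sum_prod_type]

theorem euclNorm_nonneg (x : Fin n → Fin n → ℝ) : 0 ≤ euclNorm x := Real.sqrt_nonneg _

theorem euclNorm_sq (x : Fin n → Fin n → ℝ) : euclNorm x ^ 2 = dot x x := by
  rw [← norm_vec, ← inner_vec, real_inner_self_eq_norm_sq]

theorem euclNorm_add_le (x y : Fin n → Fin n → ℝ) :
    euclNorm (x + y) ≤ euclNorm x + euclNorm y := by
  simp only [← norm_vec, vec_add]; exact norm_add_le _ _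

theorem abs_euclNorm_sub_le (x y : Fin n → Fin n → ℝ) :
    |euclNorm x - euclNorm y| ≤ euclNorm (x - y) := by
  simp only [← norm_vec, vec_sub]; exact abs_norm_sub_norm_le _ _

theorem abs_dot_le (x y : Fin n → Fin n → ℝ) : |dot x y| ≤ euclNorm x * euclNorm y := by
  simp only [← norm_vec, ← inner_vec]; exact abs_real_inner_le_norm _ _

theorem abs_apply_le_euclNorm (x : Fin n → Fin n → ℝ) (i j : Fin n) : |x i j| ≤ euclNorm x := by
  rw [← norm_vec]
  exact PiLp.norm_apply_le (vec x) (i, j)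

theorem euclNorm_sub_comm (x y : Fin n → Fin n → ℝ) : euclNorm (x - y) = euclNorm (y - x) := by
  rw [← norm_vec, ← norm_vec, vec_sub, vec_sub, norm_sub_rev]

theorem euclNorm_le_sum (x : Fin n → Fin n → ℝ) (hx : ∀ i j, 0 ≤ x i j) :
    euclNorm x ≤ ∑ i, ∑ j, x i j := by
  have h0 : 0 ≤ ∑ i, ∑ j, x i j := Finset.sum_nonneg fun i _ => Finset.sum_nonneg fun j _ => hx i j
  rw [euclNorm]
  refine Real.sqrt_le_iff.2 ⟨h0, ?_⟩
  rw [sq, Finset.sum_mul]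
  refine Finset.sum_le_sum fun i _ => ?_
  rw [Finset.sum_mul]
  refine Finset.sum_le_sum fun j _ => ?_
  rw [sq]
  refine mul_le_mul_of_nonneg_left ?_ (hx i j)
  calc x i j ≤ ∑ j', x i j' := Finset.single_le_sum (fun j _ => hx i j) (Finset.mem_univ j)
    _ ≤ _ := Finset.single_le_sum (f := fun i => ∑ j', x i j')
        (fun i _ => Finset.sum_nonneg fun j _ => hx i j) (Finset.mem_univ i)

/-- By Birkhoff–von Neumann, `x` is a convex combination of permutation matrices, and an average
cannot exceed all of its terms. -/
theorem exists_schedMat_ge_of_doublyStochastic {w x : Fin n → Fin n → ℝ}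
    (hx : ∀ i j, 0 ≤ x i j) (hr : ∀ i, ∑ j, x i j = 1) (hc : ∀ j, ∑ i, x i j = 1) :
    ∃ t : Equiv.Perm (Fin n), dot w x ≤ dot w (schedMat t) := by
  have hM : (Matrix.of x) ∈ doublyStochastic ℝ (Fin n) := by
    rw [mem_doublyStochastic_iff_sum]
    exact ⟨hx, hr, hc⟩
  obtain ⟨c, hc0, hc1, hcx⟩ := exists_eq_sum_perm_of_mem_doublyStochastic hM
  have hdot : dot w x = ∑ σ, c σ * dot w (schedMat σ) := by
    have hx' : x = ∑ σ, c σ • schedMat σ := by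
      funext i j
      have := congrFun (congrFun hcx i) j
      rw [Matrix.of_apply] at this
      rw [← this, Matrix.sum_apply, Finset.sum_apply, Finset.sum_apply]
      refine Finset.sum_congr rfl fun σ _ => ?_
      simp [schedMat, PEquiv.toMatrix_apply, Equiv.Perm.permMatrix, eq_comm]
    have hlin : ∀ S : Finset (Equiv.Perm (Fin n)),
        dot w (∑ σ ∈ S, c σ • schedMat σ) = ∑ σ ∈ S, c σ * dot w (schedMat σ) := by
      intro S
      induction S using Finset.induction_on with
      | empty => simp [dot]
      | insert σ S hσ ih => rw [Finset.sum_insert hσ, Finset.sum_insert hσ, dot_add, dot_smul, ih]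
    rw [hx', hlin]
  by_contra! hlt
  have h1 : ∑ σ, c σ * dot w (schedMat σ) < ∑ σ, c σ * dot w x := by
    obtain ⟨σ, -, hσ⟩ : ∃ σ ∈ Finset.univ, 0 < c σ := by
      by_contra! hle
      have : ∑ σ, c σ ≤ 0 := Finset.sum_nonpos hle
      linarith
    exact Finset.sum_lt_sum (fun τ _ => mul_le_mul_of_nonneg_left (hlt τ).le (hc0 τ))
      ⟨σ, Finset.mem_univ σ, mul_lt_mul_of_pos_left (hlt σ) hσ⟩
  rw [← Finset.sum_mul, hc1, one_mul] at h1
  linarith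

theorem dot_le_dot_right {w x y : Fin n → Fin n → ℝ} (hw : ∀ i j, 0 ≤ w i j)
    (hxy : ∀ i j, x i j ≤ y i j) : dot w x ≤ dot w y :=
  Finset.sum_le_sum fun i _ => Finset.sum_le_sum fun j _ =>
    mul_le_mul_of_nonneg_left (hxy i j) (hw i j)

/-- A nonnegative weight matrix is maximized over the substochastic matrices by a permutation
matrix. -/
theorem exists_schedMat_ge {w x : Fin n → Fin n → ℝ} (hw : ∀ i j, 0 ≤ w i j)
    (hx : ∀ i j, 0 ≤ x i j) (hr : ∀ i, ∑ j, x i j ≤ 1) (hc : ∀ j, ∑ i, x i j ≤ 1) :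
    ∃ t : Equiv.Perm (Fin n), dot w x ≤ dot w (schedMat t) := by
  set r : Fin n → ℝ := fun i => 1 - ∑ j, x i j with hrdef
  set c : Fin n → ℝ := fun j => 1 - ∑ i, x i j with hcdef
  have hr0 : ∀ i, 0 ≤ r i := fun i => sub_nonneg.2 (hr i)
  have hc0 : ∀ j, 0 ≤ c j := fun j => sub_nonneg.2 (hc j)
  have hrc : ∑ i, r i = ∑ j, c j := by
    simp only [hrdef, hcdef, Finset.sum_sub_distrib]
    rw [Finset.sum_comm]
  by_cases hT : ∑ i, r i = 0
  · have h1 := (Finset.sum_eq_zero_iff_of_nonneg fun i _ => hr0 i).1 hT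
    have h2 := (Finset.sum_eq_zero_iff_of_nonneg fun j _ => hc0 j).1 (hrc ▸ hT)
    refine exists_schedMat_ge_of_doublyStochastic hx (fun i => ?_) (fun j => ?_)
    · have := h1 i (Finset.mem_univ i); simp only [hrdef] at this; linarith
    · have := h2 j (Finset.mem_univ j); simp only [hcdef] at this; linarith
  have hTpos : 0 < ∑ i, r i := lt_of_le_of_ne (Finset.sum_nonneg fun i _ => hr0 i) (Ne.symm hT)
  have hadd : ∀ i j, 0 ≤ r i * c j / ∑ i, r i := fun i j =>
    div_nonneg (mul_nonneg (hr0 i) (hc0 j)) hTpos.le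
  -- Row deficits and column deficits have the same total, so adding their normalized product fills
  -- all of them at once; as `w` is nonnegative, the weight does not decrease.
  obtain ⟨t, ht⟩ := exists_schedMat_ge_of_doublyStochastic (w := w)
    (x := fun i j => x i j + r i * c j / ∑ i, r i)
    (fun i j => add_nonneg (hx i j) (hadd i j))
    (fun i => by
      rw [Finset.sum_add_distrib, ← Finset.sum_div, ← Finset.mul_sum, ← hrc,
        mul_div_cancel_right₀ _ hT]
      simp only [hrdef]; ring)
    (fun j => by
      rw [Finset.sum_add_distrib, ← Finset.sum_div, ← Finset.sum_mul, mul_div_cancel_left₀ _ hT]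
      simp only [hcdef]; ring)
  refine ⟨t, le_trans ?_ ht⟩
  exact dot_le_dot_right hw fun i j => by linarith [hadd i j]

theorem dot_schedMat (w : Fin n → Fin n → ℝ) (s : Equiv.Perm (Fin n)) :
    dot w (schedMat s) = ∑ i, w i (s i) := by
  simp [dot, schedMat]

theorem MaxWeight.dot_le {P : MaxWeight n} {q : QueueState n} {s : Equiv.Perm (Fin n)}
    (hs : s ∈ (P.schedule q).support) {x : Fin n → Fin n → ℝ}
    (hx : ∀ i j, 0 ≤ x i j) (hr : ∀ i, ∑ j, x i j ≤ 1) (hc : ∀ j, ∑ i, x i j ≤ 1) :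
    dot (toReal q) x ≤ dot (toReal q) (schedMat s) := by
  obtain ⟨t, ht⟩ := exists_schedMat_ge (w := toReal q) (fun i j => Nat.cast_nonneg _) hx hr hc
  refine ht.trans ?_
  rw [dot_schedMat, dot_schedMat]
  have := P.weight_le q s hs t
  simp only [toReal]
  exact_mod_cast this

theorem sum_schedMat_row (s : Equiv.Perm (Fin n)) (i : Fin n) : ∑ j, schedMat s i j = 1 := by
  simp [schedMat]

theorem sum_schedMat_col (s : Equiv.Perm (Fin n)) (j : Fin n) : ∑ i, schedMat s i j = 1 := by
  simp only [schedMat, ← Equiv.eq_symm_apply]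
  simp

/-- The cone of nonnegative matrices that are the sum of a row weight and a column weight. -/
def collapseCone (n : ℕ) : Set (Fin n → Fin n → ℝ) :=
  {x | (∀ i j, 0 ≤ x i j) ∧ ∀ i j k l, x i j + x k l = x i l + x k j}

/-- The exchange relation with a fixed base index splits `y` into a row weight plus a column weight,
and each is orthogonal to `w`. -/
theorem dot_eq_zero_of_mem_collapseCone {y w : Fin n → Fin n → ℝ} (hy : y ∈ collapseCone n)
    (hr : ∀ i, ∑ j, w i j = 0) (hc : ∀ j, ∑ i, w i j = 0) : dot y w = 0 := by
  rcases Nat.eq_zero_or_pos n with rfl | hn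
  · simp [dot]
  set o : Fin n := ⟨0, hn⟩
  have e : ∀ i j, y i j * w i j = y i o * w i j + (y o j - y o o) * w i j := by
    intro i j
    have := hy.2 i j o o
    rw [← add_mul]; congr 1; linarith
  simp only [dot, e, Finset.sum_add_distrib]
  rw [Finset.sum_comm (f := fun i j => (y o j - y o o) * w i j)]
  simp [← Finset.mul_sum, hr, hc]

theorem exists_collapseCone_proj (x : Fin n → Fin n → ℝ) :
    ∃ y ∈ collapseCone n, ∀ z ∈ collapseCone n, dot (x - y) (z - y) ≤ 0 := by
  let K : Set (EuclideanSpace ℝ (Fin n × Fin n)) :=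
    {v | (∀ i j, 0 ≤ v (i, j)) ∧ ∀ i j k l, v (i, j) + v (k, l) = v (i, l) + v (k, j)}
  have hclosed : IsClosed K := by
    have : K = (⋂ i, ⋂ j, {v | 0 ≤ v (i, j)}) ∩
        ⋂ i, ⋂ j, ⋂ k, ⋂ l, {v | v (i, j) + v (k, l) = v (i, l) + v (k, j)} := by
      ext v; simp [K]
    rw [this]
    refine IsClosed.inter ?_ ?_
    · exact isClosed_iInter fun i => isClosed_iInter fun j => isClosed_le (by fun_prop) (by fun_prop)
    · exact isClosed_iInter fun i => isClosed_iInter fun j => isClosed_iInter fun k =>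
        isClosed_iInter fun l => isClosed_eq (by fun_prop) (by fun_prop)
  have hconv : Convex ℝ K := by
    intro v hv w hw a b ha hb _
    refine ⟨fun i j => ?_, fun i j k l => ?_⟩
    · simp only [PiLp.add_apply, PiLp.smul_apply, smul_eq_mul]
      exact add_nonneg (mul_nonneg ha (hv.1 i j)) (mul_nonneg hb (hw.1 i j))
    · simp only [PiLp.add_apply, PiLp.smul_apply, smul_eq_mul]
      linear_combination a * hv.2 i j k l + b * hw.2 i j k l
  have hne : K.Nonempty := ⟨0, by simp [K]⟩
  obtain ⟨v, hv, hmin⟩ := exists_norm_eq_iInf_of_complete_convex hne hclosed.isComplete hconv (vec x)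
  rw [norm_eq_iInf_iff_real_inner_le_zero hconv hv] at hmin
  refine ⟨fun i j => v (i, j), hv, fun z hz => ?_⟩
  have := hmin (vec z) hz
  have e : v = vec fun i j => v (i, j) := rfl
  rw [e, ← vec_sub, ← vec_sub, inner_vec] at this
  exact this

/-- The projection of a matrix to `collapseCone`. -/
noncomputable def coneProj (x : Fin n → Fin n → ℝ) : Fin n → Fin n → ℝ :=
  (exists_collapseCone_proj x).choose

theorem coneProj_mem (x : Fin n → Fin n → ℝ) : coneProj x ∈ collapseCone n :=
  (exists_collapseCone_proj x).choose_spec.1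

theorem dot_sub_coneProj_sub_le (x : Fin n → Fin n → ℝ) {z : Fin n → Fin n → ℝ}
    (hz : z ∈ collapseCone n) : dot (x - coneProj x) (z - coneProj x) ≤ 0 :=
  (exists_collapseCone_proj x).choose_spec.2 z hz

theorem dot_sub_coneProj_self (x : Fin n → Fin n → ℝ) :
    dot (x - coneProj x) (coneProj x) = 0 := by
  have hp := coneProj_mem x
  -- Testing the variational inequality at 0 and at twice the projection, both in the cone, gives
  -- the two signs.
  have h0 := dot_sub_coneProj_sub_le x (z := 0) ⟨fun _ _ => le_rfl, by simp⟩
  have h2 := dot_sub_coneProj_sub_le x (z := (2 : ℝ) • coneProj x)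
    ⟨fun i j => by simpa using hp.1 i j, fun i j k l => by
      simp only [Pi.smul_apply, smul_eq_mul]; linear_combination 2 * hp.2 i j k l⟩
  rw [dot_sub] at h0 h2
  rw [dot_smul] at h2
  have : dot (x - coneProj x) 0 = 0 := by simp [dot]
  linarith

theorem dot_sub_coneProj_le (x : Fin n → Fin n → ℝ) {z : Fin n → Fin n → ℝ}
    (hz : z ∈ collapseCone n) : dot (x - coneProj x) z ≤ 0 := by
  have := dot_sub_coneProj_sub_le x hz
  rw [dot_sub, dot_sub_coneProj_self] at this
  linarith

/-- The indicator of a row lies in the cone and the residual in the polar cone. This sign keeps the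
tilted rate matrix in `MaxWeight.dot_sub_coneProj_le` substochastic. -/
theorem sum_sub_coneProj_row_le (x : Fin n → Fin n → ℝ) (i : Fin n) :
    ∑ j, (x - coneProj x) i j ≤ 0 := by
  have := dot_sub_coneProj_le x (z := fun i' _ => if i' = i then 1 else 0)
    ⟨fun _ _ => by dsimp only; split_ifs <;> simp, fun _ _ _ _ => rfl⟩
  simpa [dot, Finset.sum_ite_irrel] using this

theorem sum_sub_coneProj_col_le (x : Fin n → Fin n → ℝ) (j : Fin n) :
    ∑ i, (x - coneProj x) i j ≤ 0 := by
  have := dot_sub_coneProj_le x (z := fun _ j' => if j' = j then 1 else 0)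
    ⟨fun _ _ => by dsimp only; split_ifs <;> simp, fun _ _ _ _ => add_comm _ _⟩
  simpa [dot] using this

/-- The distance of a matrix to `collapseCone`. -/
noncomputable def coneDist (x : Fin n → Fin n → ℝ) : ℝ := euclNorm (x - coneProj x)

theorem coneDist_nonneg (x : Fin n → Fin n → ℝ) : 0 ≤ coneDist x := euclNorm_nonneg _

theorem coneDist_sq (x : Fin n → Fin n → ℝ) :
    coneDist x ^ 2 = dot (x - coneProj x) (x - coneProj x) := euclNorm_sq _

theorem coneDist_sq_le (x : Fin n → Fin n → ℝ) {z : Fin n → Fin n → ℝ}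
    (hz : z ∈ collapseCone n) : coneDist x ^ 2 ≤ dot (x - z) (x - z) := by
  have h1 := dot_sub_coneProj_sub_le x hz
  have e : x - z = (x - coneProj x) - (z - coneProj x) := by abel
  have h2 := dot_self_nonneg (z - coneProj x)
  rw [coneDist_sq, e]
  generalize x - coneProj x = u at *
  generalize z - coneProj x = v at *
  rw [dot_sub, sub_dot, sub_dot, dot_comm v u]
  linarith

theorem coneDist_le (x : Fin n → Fin n → ℝ) {z : Fin n → Fin n → ℝ}
    (hz : z ∈ collapseCone n) : coneDist x ≤ euclNorm (x - z) := by
  refine le_of_sq_le_sq ?_ (euclNorm_nonneg _)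
  rw [euclNorm_sq]; exact coneDist_sq_le x hz

theorem abs_coneDist_sub_le (x y : Fin n → Fin n → ℝ) :
    |coneDist x - coneDist y| ≤ euclNorm (x - y) := by
  have h : ∀ x y : Fin n → Fin n → ℝ, coneDist x ≤ coneDist y + euclNorm (x - y) := by
    intro x y
    refine (coneDist_le x (coneProj_mem y)).trans ?_
    have e : x - coneProj y = (y - coneProj y) + (x - y) := by abel
    rw [e]; exact euclNorm_add_le _ _
  rw [abs_sub_le_iff]
  refine ⟨by linarith [h x y], ?_⟩
  rw [euclNorm_sub_comm]
  linarith [h y x]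

/-- The unused service in a slot. -/
def unused (q : QueueState n) (s : Equiv.Perm (Fin n)) (a : QueueState n) : Fin n → Fin n → ℝ :=
  toReal (nextQueue q s a) - (toReal q + (toReal a - schedMat s))

theorem toReal_nextQueue (q : QueueState n) (s : Equiv.Perm (Fin n)) (a : QueueState n) :
    toReal (nextQueue q s a) = toReal q + (toReal a - schedMat s) + unused q s a := by
  simp [unused]

theorem unused_cases (q : QueueState n) (s : Equiv.Perm (Fin n)) (a : QueueState n) (i j : Fin n) :
    unused q s a i j = 0 ∨
      (unused q s a i j = 1 ∧ nextQueue q s a i j = 0 ∧ q i j = 0 ∧ schedMat s i j = 1) := by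
  simp only [unused, toReal, schedMat, nextQueue, Pi.sub_apply, Pi.add_apply]
  by_cases hs : s i = j
  · by_cases h0 : q i j + a i j = 0
    · right
      obtain ⟨h1, h2⟩ := Nat.add_eq_zero_iff.1 h0
      simp [hs, h1, h2]
    · left
      have : 1 ≤ q i j + a i j := Nat.one_le_iff_ne_zero.2 h0
      simp only [hs, if_true]
      push_cast [this]
      ring
  · left; simp [hs]

theorem unused_nonneg (q : QueueState n) (s : Equiv.Perm (Fin n)) (a : QueueState n) (i j : Fin n) :
    0 ≤ unused q s a i j := by
  rcases unused_cases q s a i j with h | h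
  · rw [h]
  · rw [h.1]; norm_num

theorem unused_le_schedMat (q : QueueState n) (s : Equiv.Perm (Fin n)) (a : QueueState n)
    (i j : Fin n) : unused q s a i j ≤ schedMat s i j := by
  rcases unused_cases q s a i j with h | h
  · rw [h]; unfold schedMat; split_ifs <;> norm_num
  · rw [h.1, h.2.2.2]

/-- Service is wasted only on a queue that is empty at the end of the slot. This complementary
slackness controls the unused service in every quadratic drift below. -/
theorem dot_nextQueue_unused (q : QueueState n) (s : Equiv.Perm (Fin n)) (a : QueueState n) :
    dot (toReal (nextQueue q s a)) (unused q s a) = 0 := by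
  refine Finset.sum_eq_zero fun i _ => Finset.sum_eq_zero fun j _ => ?_
  rcases unused_cases q s a i j with h | h
  · rw [h, mul_zero]
  · simp [toReal, h.2.1]

theorem dot_nonneg {x y : Fin n → Fin n → ℝ} (hx : ∀ i j, 0 ≤ x i j) (hy : ∀ i j, 0 ≤ y i j) :
    0 ≤ dot x y :=
  Finset.sum_nonneg fun i _ => Finset.sum_nonneg fun j _ => mul_nonneg (hx i j) (hy i j)

/-- Unused service only brings the queue lengths closer to a nonnegative matrix. -/
theorem dot_nextQueue_sub_le (q : QueueState n) (s : Equiv.Perm (Fin n)) (a : QueueState n)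
    {y : Fin n → Fin n → ℝ} (hy : ∀ i j, 0 ≤ y i j) :
    dot (toReal (nextQueue q s a) - y) (toReal (nextQueue q s a) - y)
      ≤ dot (toReal q - y) (toReal q - y) + 2 * dot (toReal q - y) (toReal a - schedMat s)
        + dot (toReal a - schedMat s) (toReal a - schedMat s) := by
  have h1 := dot_nextQueue_unused q s a
  have h2 := dot_nonneg hy (unused_nonneg q s a)
  have h3 := dot_self_nonneg (unused q s a)
  have e : toReal q - y + (toReal a - schedMat s)
      = (toReal (nextQueue q s a) - y) - unused q s a := by rw [toReal_nextQueue]; abel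
  have h4 : dot (toReal (nextQueue q s a) - y) (unused q s a) ≤ 0 := by
    rw [sub_dot]; linarith
  have h5 : dot (toReal q - y) (toReal q - y) + 2 * dot (toReal q - y) (toReal a - schedMat s)
        + dot (toReal a - schedMat s) (toReal a - schedMat s)
      = dot (toReal q - y + (toReal a - schedMat s)) (toReal q - y + (toReal a - schedMat s)) := by
    rw [dot_add, add_dot, add_dot, dot_comm (toReal a - schedMat s) (toReal q - y)]; ring
  rw [h5, e]
  generalize toReal (nextQueue q s a) - y = v at *
  rw [dot_sub, sub_dot, sub_dot, dot_comm (unused q s a) v]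
  linarith

theorem sq_sub_schedMat_le {amax : ℕ} {a : QueueState n} (ha : ∀ i j, a i j ≤ amax)
    (s : Equiv.Perm (Fin n)) (i j : Fin n) :
    (toReal a - schedMat s) i j ^ 2 ≤ ((amax : ℝ) + 1) ^ 2 := by
  have h1 : (0 : ℝ) ≤ a i j := Nat.cast_nonneg _
  have h2 : (a i j : ℝ) ≤ amax := by exact_mod_cast ha i j
  have h3 : 0 ≤ schedMat s i j ∧ schedMat s i j ≤ 1 := by
    unfold schedMat; split_ifs <;> norm_num
  simp only [Pi.sub_apply, toReal]
  refine sq_le_sq' ?_ ?_ <;> linarith [h3.1, h3.2]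

theorem dot_sub_schedMat_le {amax : ℕ} {a : QueueState n} (ha : ∀ i j, a i j ≤ amax)
    (s : Equiv.Perm (Fin n)) :
    dot (toReal a - schedMat s) (toReal a - schedMat s) ≤ (n : ℝ) ^ 2 * ((amax : ℝ) + 1) ^ 2 := by
  calc _ ≤ ∑ _i : Fin n, ∑ _j : Fin n, ((amax : ℝ) + 1) ^ 2 := by
        refine Finset.sum_le_sum fun i _ => Finset.sum_le_sum fun j _ => ?_
        rw [← sq]; exact sq_sub_schedMat_le ha s i j
    _ = _ := by simp; ring

theorem euclNorm_nextQueue_sub_le {amax : ℕ} (q : QueueState n) {a : QueueState n}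
    (ha : ∀ i j, a i j ≤ amax) (s : Equiv.Perm (Fin n)) :
    euclNorm (toReal (nextQueue q s a) - toReal q) ≤ n * ((amax : ℝ) + 1) := by
  refine le_of_sq_le_sq ?_ (by positivity)
  rw [euclNorm_sq]
  calc _ ≤ ∑ _i : Fin n, ∑ _j : Fin n, ((amax : ℝ) + 1) ^ 2 := by
        refine Finset.sum_le_sum fun i _ => Finset.sum_le_sum fun j _ => ?_
        rw [← sq]
        have h1 : (nextQueue q s a i j : ℝ) ≤ q i j + amax := by
          have := ha i j
          have : nextQueue q s a i j ≤ q i j + amax := by unfold nextQueue; omega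
          exact_mod_cast this
        have h2 : (q i j : ℝ) ≤ nextQueue q s a i j + 1 := by
          have : q i j ≤ nextQueue q s a i j + 1 := by unfold nextQueue; split_ifs <;> omega
          exact_mod_cast this
        have h3 : (0 : ℝ) ≤ amax := Nat.cast_nonneg _
        simp only [Pi.sub_apply, toReal]
        refine sq_le_sq' ?_ ?_ <;> linarith
    _ = _ := by simp; ring

end Geometry

/-! ### State space collapse, stability and uniqueness of the steady state -/

section Drift

variable {n : ℕ} {p : Fin n → Fin n → PMF ℕ} {amax : ℕ} {lam : Fin n → Fin n → ℝ}

theorem IsArrival.integral_dot_nextQueue_sub_le (h : IsArrival amax lam p) (q : QueueState n)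
    (s : Equiv.Perm (Fin n)) {y : Fin n → Fin n → ℝ} (hy : ∀ i j, 0 ≤ y i j) :
    ∫ a, dot (toReal (nextQueue q s a) - y) (toReal (nextQueue q s a) - y) ∂arrivalLaw p
      ≤ dot (toReal q - y) (toReal q - y) + 2 * dot (toReal q - y) (lam - schedMat s)
        + (n : ℝ) ^ 2 * ((amax : ℝ) + 1) ^ 2 := by
  have h1 : ∫ a, dot (toReal (nextQueue q s a) - y) (toReal (nextQueue q s a) - y) ∂arrivalLaw p
      ≤ ∫ a, (2 * dot (toReal q - y) (toReal a) + (dot (toReal q - y) (toReal q - y)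
        - 2 * dot (toReal q - y) (schedMat s) + (n : ℝ) ^ 2 * ((amax : ℝ) + 1) ^ 2))
        ∂arrivalLaw p := by
    refine integral_mono_ae (h.integrable _) (h.integrable _) ?_
    filter_upwards [h.ae_le] with a ha
    have e1 := dot_nextQueue_sub_le q s a hy
    have e2 := dot_sub_schedMat_le ha s
    rw [dot_sub (toReal q - y) (toReal a)] at e1
    linarith
  rw [integral_add (h.integrable _) (integrable_const _), integral_const_mul, h.integral_dot] at h1
  simp only [integral_const, probReal_univ, smul_eq_mul, one_mul] at h1
  rw [dot_sub (toReal q - y) lam]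
  linarith

/-- The schedule beats the matrix obtained from `ν` by moving a distance `m` in the direction of the
residual. The cone part of the queue does not see `ν - schedMat s`, whose row and column sums
vanish, so the whole gain appears in the residual. -/
theorem MaxWeight.dot_sub_coneProj_le {P : MaxWeight n} {q : QueueState n}
    {s : Equiv.Perm (Fin n)} (hs : s ∈ (P.schedule q).support) {ν : Fin n → Fin n → ℝ} {m : ℝ}
    (hm : 0 ≤ m) (hν : ∀ i j, m ≤ ν i j) (hr : ∀ i, ∑ j, ν i j = 1) (hc : ∀ j, ∑ i, ν i j = 1) :
    dot (toReal q - coneProj (toReal q)) (ν - schedMat s) ≤ -(m * coneDist (toReal q)) := by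
  set z := toReal q - coneProj (toReal q) with hz
  set d := coneDist (toReal q) with hd
  have hd0 : 0 ≤ d := coneDist_nonneg _
  have hy : dot (coneProj (toReal q)) (ν - schedMat s) = 0 := by
    refine dot_eq_zero_of_mem_collapseCone (coneProj_mem _) (fun i => ?_) (fun j => ?_)
    · simp only [Pi.sub_apply, Finset.sum_sub_distrib, hr, sum_schedMat_row, sub_self]
    · simp only [Pi.sub_apply, Finset.sum_sub_distrib, hc, sum_schedMat_col, sub_self]
  have hzq : dot z (ν - schedMat s) = dot (toReal q) ν - dot (toReal q) (schedMat s) := by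
    rw [hz, sub_dot, hy, sub_zero, dot_sub]
  have hqz : dot (toReal q) z = d ^ 2 := by
    rw [hd, coneDist_sq]
    have := dot_sub_coneProj_self (toReal q)
    rw [← hz] at this ⊢
    have e : toReal q = z + coneProj (toReal q) := by rw [hz]; abel
    conv_lhs => rw [e]
    rw [add_dot, dot_comm (coneProj _) z, this, add_zero]
  have hmd : 0 ≤ m / d := div_nonneg hm hd0
  -- Entries stay nonnegative because `|z i j| ≤ d` and `m ≤ ν i j`. For `d = 0` the quotient is 0
  -- by convention, and the matrix is just `ν`.
  have key := MaxWeight.dot_le hs (x := ν + (m / d) • z)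
    (fun i j => by
      simp only [Pi.add_apply, Pi.smul_apply, smul_eq_mul]
      rcases hd0.eq_or_lt with h0 | h0
      · rw [← h0]; simp only [div_zero, zero_mul, add_zero]; exact hm.trans (hν i j)
      have h1 : -d ≤ z i j := (abs_le.1 (abs_apply_le_euclNorm z i j)).1
      have h2 : m / d * (-d) ≤ m / d * z i j := mul_le_mul_of_nonneg_left h1 hmd
      have h3 : m / d * (-d) = -m := by field_simp
      linarith [hν i j])
    (fun i => by
      simp only [Pi.add_apply, Pi.smul_apply, smul_eq_mul, Finset.sum_add_distrib, hr,
        ← Finset.mul_sum]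
      have := mul_nonneg hmd (neg_nonneg.2 (sum_sub_coneProj_row_le (toReal q) i))
      linarith)
    (fun j => by
      simp only [Pi.add_apply, Pi.smul_apply, smul_eq_mul, Finset.sum_add_distrib, hc,
        ← Finset.mul_sum]
      have := mul_nonneg hmd (neg_nonneg.2 (sum_sub_coneProj_col_le (toReal q) j))
      linarith)
  rw [dot_add, dot_smul, hqz] at key
  have e : m / d * d ^ 2 = m * d := by
    rcases hd0.eq_or_lt with h0 | h0
    · rw [← h0]; simp
    · field_simp
  rw [hzq]
  linarith

variable {ν k : Fin n → Fin n → ℝ} {ε : ℝ}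

/-- The next state is compared with the projection of the current one, which can only overestimate
the new distance. The drift -2md from MaxWeight loses at most half to the perturbation `ε • k`. -/
theorem IsArrival.integral_coneDist_sq_le (h : IsArrival amax (fun i j => ν i j - ε * k i j) p)
    (P : MaxWeight n) {m : ℝ} (hm : 0 ≤ m) (hν : ∀ i j, m ≤ ν i j)
    (hr : ∀ i, ∑ j, ν i j = 1) (hc : ∀ j, ∑ i, ν i j = 1) (hε : 0 ≤ ε)
    (hεk : ε * euclNorm k ≤ m / 2) (q : QueueState n) :
    ∫ y, coneDist (toReal y) ^ 2 ∂queueKernel p P q ≤ coneDist (toReal q) ^ 2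
      - 2 * (m / 2) * coneDist (toReal q) + (n : ℝ) ^ 2 * ((amax : ℝ) + 1) ^ 2 := by
  refine h.integral_queueKernel_le P q _ fun s hs => ?_
  have h1 : ∫ a, coneDist (toReal (nextQueue q s a)) ^ 2 ∂arrivalLaw p
      ≤ ∫ a, dot (toReal (nextQueue q s a) - coneProj (toReal q))
          (toReal (nextQueue q s a) - coneProj (toReal q)) ∂arrivalLaw p :=
    integral_mono (h.integrable _) (h.integrable _) fun a =>
      coneDist_sq_le _ (coneProj_mem (toReal q))
  refine h1.trans ((h.integral_dot_nextQueue_sub_le q s (coneProj_mem (toReal q)).1).trans ?_)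
  rw [← coneDist_sq]
  have e : (fun i j => ν i j - ε * k i j) - schedMat s = (ν - schedMat s) - ε • k := by
    funext i j; simp; ring
  have h2 := MaxWeight.dot_sub_coneProj_le hs hm hν hr hc
  have h3 : |dot (toReal q - coneProj (toReal q)) k| ≤ coneDist (toReal q) * euclNorm k :=
    abs_dot_le _ _
  have h4 : -(ε * (coneDist (toReal q) * euclNorm k))
      ≤ ε * dot (toReal q - coneProj (toReal q)) k := by
    rw [← mul_neg]; exact mul_le_mul_of_nonneg_left (neg_le_of_abs_le h3) hε
  have h5 : ε * (coneDist (toReal q) * euclNorm k) ≤ m / 2 * coneDist (toReal q) := by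
    calc _ = (ε * euclNorm k) * coneDist (toReal q) := by ring
      _ ≤ _ := mul_le_mul_of_nonneg_right hεk (coneDist_nonneg _)
  rw [e, dot_sub, dot_smul]
  linarith

/-- The second moment of the distance to the collapse cone is bounded uniformly in the load. -/
theorem IsSteadyState.coneDist_sq (h : IsArrival amax (fun i j => ν i j - ε * k i j) p)
    {P : MaxWeight n} {μ : Measure (QueueState n)} (hμ : IsSteadyState p P μ) {m : ℝ} (hm : 0 < m)
    (hν : ∀ i j, m ≤ ν i j) (hr : ∀ i, ∑ j, ν i j = 1) (hc : ∀ j, ∑ i, ν i j = 1) (hε : 0 ≤ ε)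
    (hεk : ε * euclNorm k ≤ m / 2) :
    Integrable (fun q => coneDist (toReal q) ^ 2) μ ∧ ∫ q, coneDist (toReal q) ^ 2 ∂μ
      ≤ ((3 / 2 * ((n : ℝ) ^ 2 * ((amax : ℝ) + 1) ^ 2 + (n * ((amax : ℝ) + 1)) ^ 2)) ^ 2
        / (4 * (m / 2)) + (n * ((amax : ℝ) + 1)) ^ 3) / (2 * (m / 2)) := by
  have := hμ.1
  refine integrable_sq_of_drift hμ.2 (d := fun q => coneDist (toReal q)) (by positivity)
    (by positivity) (by positivity) (fun q => coneDist_nonneg _) (fun q => ?_)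
    (fun q => h.integral_coneDist_sq_le P hm.le hν hr hc hε hεk q)
  exact h.ae_queueKernel P q (S := fun y => |coneDist (toReal y) - coneDist (toReal q)| ≤ _)
    fun s a ha => (abs_coneDist_sub_le _ _).trans (euclNorm_nextQueue_sub_le q ha s)

/-- The rates stay substochastic after adding `c` to every entry, so MaxWeight outperforms them by
`c` times the total queue length, which dominates the Euclidean norm. -/
theorem IsArrival.integral_euclNorm_sq_le (h : IsArrival amax lam p) (P : MaxWeight n) {c : ℝ}
    (hc0 : 0 ≤ c) (hr : ∀ i, ∑ j, (lam i j + c) ≤ 1) (hc : ∀ j, ∑ i, (lam i j + c) ≤ 1)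
    (q : QueueState n) :
    ∫ y, euclNorm (toReal y) ^ 2 ∂queueKernel p P q ≤ euclNorm (toReal q) ^ 2
      - 2 * c * euclNorm (toReal q) + (n : ℝ) ^ 2 * ((amax : ℝ) + 1) ^ 2 := by
  refine h.integral_queueKernel_le P q _ fun s hs => ?_
  have h1 := h.integral_dot_nextQueue_sub_le q s (y := 0) fun _ _ => le_rfl
  simp only [sub_zero, ← euclNorm_sq] at h1
  refine h1.trans ?_
  have h2 := MaxWeight.dot_le hs (x := lam + fun _ _ => c)
    (fun i j => add_nonneg (h.mean_nonneg i j) hc0) hr hc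
  have h3 := euclNorm_le_sum (toReal q) fun i j => Nat.cast_nonneg _
  have h4 : dot (toReal q) (fun _ _ => c) = c * ∑ i, ∑ j, toReal q i j := by
    simp only [dot, Finset.mul_sum, mul_comm]
  have h5 := mul_le_mul_of_nonneg_left h3 hc0
  rw [dot_add, h4] at h2
  rw [dot_sub]
  linarith

/-- Below capacity, steady-state queue lengths have finite second moments. -/
theorem IsSteadyState.integrable_euclNorm_sq (h : IsArrival amax lam p)
    {P : MaxWeight n} {μ : Measure (QueueState n)} (hμ : IsSteadyState p P μ) {c : ℝ} (hc0 : 0 < c)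
    (hr : ∀ i, ∑ j, (lam i j + c) ≤ 1) (hc : ∀ j, ∑ i, (lam i j + c) ≤ 1) :
    Integrable (fun q => euclNorm (toReal q) ^ 2) μ := by
  have := hμ.1
  refine (integrable_sq_of_drift hμ.2 (d := fun q => euclNorm (toReal q)) (c := c)
    (K := (n : ℝ) ^ 2 * ((amax : ℝ) + 1) ^ 2) (B := n * ((amax : ℝ) + 1)) hc0
    (by positivity) (by positivity) (fun q => euclNorm_nonneg _) (fun q => ?_)
    (fun q => h.integral_euclNorm_sq_le P hc0.le hr hc q)).1
  exact h.ae_queueKernel P q (S := fun y => |euclNorm (toReal y) - euclNorm (toReal q)| ≤ _)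
    fun s a ha => (abs_euclNorm_sub_le _ _).trans (euclNorm_nextQueue_sub_le q ha s)

theorem IsArrival.exists_isSteadyState (h : IsArrival amax lam p) (P : MaxWeight n) {c : ℝ}
    (hc0 : 0 < c) (hr : ∀ i, ∑ j, (lam i j + c) ≤ 1) (hc : ∀ j, ∑ i, (lam i j + c) ≤ 1) :
    ∃ μ, IsSteadyState p P μ := by
  refine exists_invariant_of_drift (κ := queueKernel p P)
    (V := fun q => ENNReal.ofReal (euclNorm (toReal q) ^ 2))
    (f := fun q => ENNReal.ofReal (2 * c * euclNorm (toReal q)))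
    (b := ENNReal.ofReal ((n : ℝ) ^ 2 * ((amax : ℝ) + 1) ^ 2)) 0 ENNReal.ofReal_ne_top
    ENNReal.ofReal_ne_top ?_ ?_
  · intro R
    obtain ⟨M, hM⟩ := exists_nat_ge ((R : ℝ) / (2 * c))
    refine (Set.finite_Iic (fun _ _ => M : QueueState n)).subset fun q hq => ?_
    rw [Set.mem_ofPred_eq, ← ENNReal.ofReal_natCast, ENNReal.ofReal_lt_ofReal_iff_of_nonneg
      (mul_nonneg (by positivity) (euclNorm_nonneg _))] at hq
    have h1 : euclNorm (toReal q) ≤ M := by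
      refine le_trans ?_ hM
      rw [le_div_iff₀ (by positivity)]; linarith
    intro i j
    have h2 := (le_abs_self _).trans ((abs_apply_le_euclNorm (toReal q) i j).trans h1)
    unfold toReal at h2
    exact_mod_cast h2
  · intro q
    rw [← ofReal_integral_eq_lintegral_ofReal (h.integrable_queueKernel P q _)
      (ae_of_all _ fun y => sq_nonneg _),
      ← ENNReal.ofReal_add (integral_nonneg fun y => sq_nonneg _)
        (mul_nonneg (by positivity) (euclNorm_nonneg _)),
      ← ENNReal.ofReal_add (sq_nonneg _) (by positivity)]
    refine ENNReal.ofReal_le_ofReal ?_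
    have := h.integral_euclNorm_sq_le P hc0.le hr hc q
    linarith

/-- From a nonempty state, a slot without arrivals leads to a state with fewer packets. -/
theorem IsArrival.exists_smaller (h : IsArrival amax lam p) (hlt : ∀ i j, lam i j < 1)
    (P : MaxWeight n) {q : QueueState n} (hq : q ≠ 0) :
    ∃ y, ∑ i, ∑ j, y i j < ∑ i, ∑ j, q i j ∧ queueKernel p P q {y} ≠ 0 := by
  obtain ⟨s, hs⟩ := (P.schedule q).support_nonempty
  refine ⟨nextQueue q s 0, ?_, queueKernel_nextQueue_ne_zero P hs (h.arrivalLaw_zero_ne_zero hlt)⟩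
  -- A transposition (or the identity) passes through any chosen nonempty queue, so the maximal
  -- weight is positive and some nonempty queue is served.
  have hpos : ∃ i, 0 < q i (s i) := by
    by_contra! hle
    obtain ⟨i, hi⟩ := Function.ne_iff.1 hq
    obtain ⟨j, hj⟩ := Function.ne_iff.1 hi
    have h1 := P.weight_le q s hs (Equiv.swap i j)
    have h2 : ∑ i, q i (s i) = 0 := Finset.sum_eq_zero fun i _ => Nat.le_zero.1 (hle i)
    have h3 : q i (Equiv.swap i j i) ≤ ∑ i', q i' (Equiv.swap i j i') :=
      Finset.single_le_sum (f := fun i' => q i' (Equiv.swap i j i')) (fun _ _ => Nat.zero_le _)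
        (Finset.mem_univ i)
    rw [Equiv.swap_apply_left] at h3
    exact hj (Nat.le_zero.1 (h3.trans (h1.trans h2.le)))
  obtain ⟨i₀, hi₀⟩ := hpos
  have hle : ∀ i j, nextQueue q s 0 i j ≤ q i j := fun i j => by
    simp only [nextQueue, Pi.zero_apply]; omega
  refine Finset.sum_lt_sum (fun i _ => Finset.sum_le_sum fun j _ => hle i j)
    ⟨i₀, Finset.mem_univ _, Finset.sum_lt_sum (fun j _ => hle i₀ j)
      ⟨s i₀, Finset.mem_univ _, ?_⟩⟩
  simp only [nextQueue, Pi.zero_apply, if_true]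
  omega

theorem IsArrival.existsUnique_isSteadyState (h : IsArrival amax lam p) (hlt : ∀ i j, lam i j < 1)
    (P : MaxWeight n) {c : ℝ} (hc0 : 0 < c) (hr : ∀ i, ∑ j, (lam i j + c) ≤ 1)
    (hc : ∀ j, ∑ i, (lam i j + c) ≤ 1) : ∃! μ, IsSteadyState p P μ := by
  obtain ⟨μ, hμ⟩ := h.exists_isSteadyState P hc0 hr hc
  refine ⟨μ, hμ, fun ρ hρ => ?_⟩
  have := hμ.1
  have := hρ.1
  exact eq_of_invariant_of_accessible hρ.2 hμ.2 (fun q => ∑ i, ∑ j, q i j)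
    fun q hq => h.exists_smaller hlt P hq

theorem IsSteadyState.apply_zero_ne_zero (h : IsArrival amax lam p) (hlt : ∀ i j, lam i j < 1)
    {P : MaxWeight n} {μ : Measure (QueueState n)} (hμ : IsSteadyState p P μ) : μ {0} ≠ 0 := by
  intro h0
  have := hμ.1
  have := eq_zero_of_invariant_of_accessible hμ.2 (fun q => ∑ i, ∑ j, q i j)
    (fun q hq => h.exists_smaller hlt P hq) h0
  exact (IsProbabilityMeasure.ne_zero μ) this

theorem dot_unused_nonneg {w : Fin n → Fin n → ℝ} (hw : ∀ i j, 0 ≤ w i j) (q : QueueState n)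
    (s : Equiv.Perm (Fin n)) (a : QueueState n) : 0 ≤ dot w (unused q s a) :=
  dot_nonneg hw (unused_nonneg q s a)

/-- In steady state, the weight of the arrivals is smaller than the weight of the service. -/
theorem IsSteadyState.dot_lt_one (h : IsArrival amax lam p) (hlt : ∀ i j, lam i j < 1)
    {P : MaxWeight n} {μ : Measure (QueueState n)} (hμ : IsSteadyState p P μ)
    {w : Fin n → Fin n → ℝ} (hw : ∀ i j, 0 ≤ w i j)
    (hws : ∀ s : Equiv.Perm (Fin n), dot w (schedMat s) = 1) : dot w lam < 1 := by
  by_contra! hge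
  have := hμ.1
  set F : QueueState n → ℝ := fun q => dot w (toReal q) with hF
  have hinc : ∀ q, ∀ᵐ y ∂queueKernel p P q,
      |F y - F q| ≤ euclNorm w * (n * ((amax : ℝ) + 1)) := fun q =>
    h.ae_queueKernel P q (S := fun y => |F y - F q| ≤ euclNorm w * (n * ((amax : ℝ) + 1)))
      fun s a ha => by
        simp only [hF]
        rw [← dot_sub]
        exact (abs_dot_le _ _).trans
          (mul_le_mul_of_nonneg_left (euclNorm_nextQueue_sub_le q ha s) (euclNorm_nonneg _))
  obtain ⟨i1, i2⟩ := integral_drift_eq_zero hμ.2 (F := F)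
    (mul_nonneg (euclNorm_nonneg w) (by positivity))
    (fun q => dot_nonneg hw fun i j => Nat.cast_nonneg _) hinc
  have hstep : ∀ q, ∫ y, F y ∂queueKernel p P q - F q = dot w lam - 1
      + ∑ s, (P.schedule q s).toReal * ∫ a, dot w (unused q s a) ∂arrivalLaw p := by
    intro q
    have e : ∀ s, ∫ a, F (nextQueue q s a) ∂arrivalLaw p
        = (F q + dot w lam - 1) + ∫ a, dot w (unused q s a) ∂arrivalLaw p := by
      intro s
      simp only [hF, toReal_nextQueue, dot_add, dot_sub, hws]
      rw [integral_add (h.integrable _) (h.integrable _),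
        integral_add (h.integrable _) (h.integrable _),
        integral_sub (h.integrable _) (h.integrable _), h.integral_dot]
      simp only [integral_const, probReal_univ, smul_eq_mul, one_mul]
      ring
    rw [h.integral_queueKernel]
    simp only [e, mul_add, Finset.sum_add_distrib]
    rw [← Finset.sum_mul, ← ENNReal.toReal_sum fun s _ => (P.schedule q).apply_ne_top s,
      sum_schedule, ENNReal.toReal_one]
    ring
  have hnn : ∀ q, 0 ≤ ∫ y, F y ∂queueKernel p P q - F q := by
    intro q
    rw [hstep]
    have : 0 ≤ ∑ s, (P.schedule q s).toReal * ∫ a, dot w (unused q s a) ∂arrivalLaw p :=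
      Finset.sum_nonneg fun s _ => mul_nonneg ENNReal.toReal_nonneg
        (integral_nonneg fun a => dot_unused_nonneg hw q s a)
    linarith
  -- If the load were at least 1, the drift would be nonnegative with mean zero, hence zero at the
  -- empty state, which has positive mass. But there a slot without arrivals wastes the entire
  -- schedule, so the drift is positive.
  have hae := (integral_eq_zero_iff_of_nonneg hnn i1).1 i2
  have h0 := ae_iff_of_countable.1 hae 0 (IsSteadyState.apply_zero_ne_zero h hlt hμ)
  simp only [Pi.zero_apply] at h0
  rw [hstep] at h0
  obtain ⟨s, hs⟩ := (P.schedule (0 : QueueState n)).support_nonempty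
  have hu : unused 0 s 0 = schedMat s := by
    funext i j
    simp [unused, toReal, nextQueue, schedMat]
  have hpos : 0 < ∫ a, dot w (unused 0 s a) ∂arrivalLaw p := by
    rw [integral_pos_iff_support_of_nonneg (fun a => dot_unused_nonneg hw 0 s a)
      (h.integrable _)]
    refine (pos_iff_ne_zero.2 (h.arrivalLaw_zero_ne_zero hlt)).trans_le
      (measure_mono (Set.singleton_subset_iff.2 ?_))
    rw [Function.mem_support, hu, hws]
    exact one_ne_zero
  have h1 : (P.schedule 0 s).toReal * ∫ a, dot w (unused 0 s a) ∂arrivalLaw p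
      ≤ ∑ s, (P.schedule 0 s).toReal * ∫ a, dot w (unused 0 s a) ∂arrivalLaw p :=
    Finset.single_le_sum
      (f := fun s => (P.schedule 0 s).toReal * ∫ a, dot w (unused 0 s a) ∂arrivalLaw p)
      (fun s _ => mul_nonneg ENNReal.toReal_nonneg
        (integral_nonneg fun a => dot_unused_nonneg hw 0 s a)) (Finset.mem_univ s)
  have h2 : 0 < (P.schedule 0 s).toReal :=
    ENNReal.toReal_pos hs ((P.schedule 0).apply_ne_top s)
  have h3 := mul_pos h2 hpos
  linarith

theorem IsSteadyState.sum_row_lt_one (h : IsArrival amax lam p) (hlt : ∀ i j, lam i j < 1)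
    {P : MaxWeight n} {μ : Measure (QueueState n)} (hμ : IsSteadyState p P μ) (i : Fin n) :
    ∑ j, lam i j < 1 := by
  have := IsSteadyState.dot_lt_one h hlt hμ (w := fun i' _ => if i' = i then 1 else 0)
    (fun _ _ => by split_ifs <;> simp) (fun s => by simp [dot_schedMat])
  simpa [dot, Finset.sum_ite_irrel] using this

theorem IsSteadyState.sum_col_lt_one (h : IsArrival amax lam p) (hlt : ∀ i j, lam i j < 1)
    {P : MaxWeight n} {μ : Measure (QueueState n)} (hμ : IsSteadyState p P μ) (j : Fin n) :
    ∑ i, lam i j < 1 := by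
  have := IsSteadyState.dot_lt_one h hlt hμ (w := fun _ j' => if j' = j then 1 else 0)
    (fun _ _ => by split_ifs <;> simp)
    (fun s => by rw [dot_schedMat]; simp only [← Equiv.eq_symm_apply]; simp)
  simpa [dot] using this

end Drift

/-! ### Drift of the squared projection to the span of the cone -/

section HeavyTraffic

variable {n : ℕ}

/-- The matrix that is `1` on row `i` and `0` elsewhere. -/
def rowInd (i : Fin n) : Fin n → Fin n → ℝ := fun i' _ => if i' = i then 1 else 0

/-- The matrix that is `1` on column `j` and `0` elsewhere. -/
def colInd (j : Fin n) : Fin n → Fin n → ℝ := fun _ j' => if j' = j then 1 else 0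

theorem dot_rowInd (i : Fin n) (x : Fin n → Fin n → ℝ) : dot (rowInd i) x = ∑ j, x i j := by
  simp [dot, rowInd, Finset.sum_ite_irrel]

theorem dot_colInd (j : Fin n) (x : Fin n → Fin n → ℝ) : dot (colInd j) x = ∑ i, x i j := by
  simp [dot, colInd]

theorem one_dot (x : Fin n → Fin n → ℝ) : dot 1 x = ∑ i, ∑ j, x i j := by
  simp [dot]

/-- The orthogonal projection to the span of `collapseCone`. -/
noncomputable def spanProj (x : Fin n → Fin n → ℝ) : Fin n → Fin n → ℝ :=
  fun i j => (dot (rowInd i) x + dot (colInd j) x) / n - dot 1 x / (n : ℝ) ^ 2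

theorem spanProj_add (x y : Fin n → Fin n → ℝ) : spanProj (x + y) = spanProj x + spanProj y := by
  funext i j; simp only [spanProj, dot_add, Pi.add_apply]; ring

theorem spanProj_sub (x y : Fin n → Fin n → ℝ) : spanProj (x - y) = spanProj x - spanProj y := by
  funext i j; simp only [spanProj, dot_sub, Pi.sub_apply]; ring

theorem spanProj_smul (c : ℝ) (x : Fin n → Fin n → ℝ) : spanProj (c • x) = c • spanProj x := by
  funext i j; simp only [spanProj, dot_smul, Pi.smul_apply, smul_eq_mul]; ring

/-- In terms of row sums, column sums and the total, symmetry is visible and the mean of the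
quadratic form reduces to variances of sums. -/
theorem dot_spanProj (x y : Fin n → Fin n → ℝ) : dot x (spanProj y)
    = (∑ i, dot (rowInd i) x * dot (rowInd i) y + ∑ j, dot (colInd j) x * dot (colInd j) y) / n
      - dot 1 x * dot 1 y / (n : ℝ) ^ 2 := by
  have e : ∀ i j, x i j * spanProj y i j = x i j * (dot (rowInd i) y / n)
      + x i j * (dot (colInd j) y / n) - x i j * (dot 1 y / (n : ℝ) ^ 2) := by
    intro i j; simp only [spanProj]; ring
  rw [dot]
  simp only [e, Finset.sum_sub_distrib, Finset.sum_add_distrib]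
  rw [Finset.sum_comm (f := fun i j => x i j * (dot (colInd j) y / n))]
  simp only [← Finset.sum_mul, ← dot_rowInd _ x, ← dot_colInd _ x]
  have e1 : ∑ i, dot (rowInd i) x = dot 1 x := by simp only [dot_rowInd, one_dot]
  simp only [mul_div_assoc', ← Finset.sum_div, e1]
  ring

theorem dot_spanProj_comm (x y : Fin n → Fin n → ℝ) :
    dot x (spanProj y) = dot y (spanProj x) := by
  simp only [dot_spanProj, mul_comm]

theorem spanProj_eq_zero {w : Fin n → Fin n → ℝ} (hr : ∀ i, ∑ j, w i j = 0)
    (hc : ∀ j, ∑ i, w i j = 0) : spanProj w = 0 := by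
  funext i j; simp [spanProj, dot_rowInd, dot_colInd, one_dot, hr, hc]

theorem spanProj_of_mem_collapseCone {y : Fin n → Fin n → ℝ} (hy : y ∈ collapseCone n) :
    spanProj y = y := by
  funext i j
  have hn : (n : ℝ) ≠ 0 := Nat.cast_ne_zero.2 i.pos.ne'
  have e1 : ∀ l, ∑ k, y k l = ∑ k, y k j + n * (y i l - y i j) := by
    intro l
    have : ∀ k, y k l = y k j + (y i l - y i j) := fun k => by
      have := hy.2 k l i j; linarith
    rw [Finset.sum_congr rfl fun k _ => this k, Finset.sum_add_distrib]
    simp [mul_sub]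
  have e2 : ∑ k, ∑ l, y k l = n * ∑ k, y k j + n * (∑ l, y i l - n * y i j) := by
    rw [Finset.sum_comm]
    rw [Finset.sum_congr rfl fun l _ => e1 l, Finset.sum_add_distrib, ← Finset.mul_sum,
      Finset.sum_sub_distrib]
    simp
  simp only [spanProj, dot_rowInd, dot_colInd, one_dot, e2]
  field_simp
  ring

theorem abs_sum_le_mul (f : Fin n → ℝ) {b : ℝ} (hf : ∀ i, |f i| ≤ b) :
    |∑ i, f i| ≤ n * b := by
  refine (Finset.abs_sum_le_sum_abs _ _).trans ((Finset.sum_le_sum fun i _ => hf i).trans ?_)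
  simp

theorem abs_spanProj_le (x : Fin n → Fin n → ℝ) (i j : Fin n) :
    |spanProj x i j| ≤ 3 * euclNorm x := by
  have hn : (0 : ℝ) < n := Nat.cast_pos.2 i.pos
  have hr : ∀ i, |dot (rowInd i) x| ≤ n * euclNorm x := fun i => by
    rw [dot_rowInd]; exact abs_sum_le_mul _ fun j => abs_apply_le_euclNorm x i j
  have hc : |dot (colInd j) x| ≤ n * euclNorm x := by
    rw [dot_colInd]; exact abs_sum_le_mul _ fun i => abs_apply_le_euclNorm x i j
  have ht : |dot 1 x| ≤ n * (n * euclNorm x) := by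
    rw [one_dot]
    exact abs_sum_le_mul _ fun i => (dot_rowInd i x) ▸ hr i
  have e1 : |dot (rowInd i) x / n| ≤ euclNorm x := by
    rw [abs_div, abs_of_pos hn, div_le_iff₀ hn]; linarith [hr i]
  have e2 : |dot (colInd j) x / n| ≤ euclNorm x := by
    rw [abs_div, abs_of_pos hn, div_le_iff₀ hn]; linarith
  have e3 : |dot 1 x / (n : ℝ) ^ 2| ≤ euclNorm x := by
    rw [abs_div, abs_of_pos (by positivity : (0 : ℝ) < (n : ℝ) ^ 2), div_le_iff₀ (by positivity)]
    linarith
  simp only [spanProj, add_div]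
  have := abs_le.1 e1
  have := abs_le.1 e2
  have := abs_le.1 e3
  rw [abs_le]
  constructor <;> linarith

/-- The projection fixes the cone, so `x` may be replaced by its residual; the constant is 1 for the
residual plus 3 for its projection. -/
theorem abs_sub_spanProj_le (x : Fin n → Fin n → ℝ) (i j : Fin n) :
    |(x - spanProj x) i j| ≤ 4 * coneDist x := by
  have e : x - spanProj x = (x - coneProj x) - spanProj (x - coneProj x) := by
    rw [spanProj_sub, spanProj_of_mem_collapseCone (coneProj_mem x)]; abel
  rw [e]
  have h1 := abs_le.1 (abs_apply_le_euclNorm (x - coneProj x) i j)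
  have h2 := abs_le.1 (abs_spanProj_le (x - coneProj x) i j)
  change |(x - coneProj x) i j - spanProj (x - coneProj x) i j| ≤ 4 * euclNorm (x - coneProj x)
  rw [abs_le]
  constructor <;> linarith

theorem abs_dot_le_mul_sum {w u : Fin n → Fin n → ℝ} {b : ℝ} (hw : ∀ i j, |w i j| ≤ b)
    (hu : ∀ i j, 0 ≤ u i j) : |dot w u| ≤ b * dot 1 u := by
  rw [one_dot, dot, Finset.mul_sum]
  refine (Finset.abs_sum_le_sum_abs _ _).trans (Finset.sum_le_sum fun i _ => ?_)
  rw [Finset.mul_sum]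
  refine (Finset.abs_sum_le_sum_abs _ _).trans (Finset.sum_le_sum fun j _ => ?_)
  rw [abs_mul, abs_of_nonneg (hu i j)]
  exact mul_le_mul_of_nonneg_right (hw i j) (hu i j)

theorem one_dot_schedMat (s : Equiv.Perm (Fin n)) : dot 1 (schedMat s) = n := by
  rw [dot_schedMat]; simp

theorem one_dot_unused_le (q : QueueState n) (s : Equiv.Perm (Fin n)) (a : QueueState n) :
    dot 1 (unused q s a) ≤ n := by
  rw [← one_dot_schedMat s]
  exact dot_le_dot_right (fun _ _ => zero_le_one) (unused_le_schedMat q s a)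

/-- One-step change of the squared length of the projection to the span of the collapse cone. -/
theorem abs_spanProj_step_le (q : QueueState n) (s : Equiv.Perm (Fin n)) (a : QueueState n)
    {η : ℝ} (hη : 0 < η) :
    |dot (toReal (nextQueue q s a)) (spanProj (toReal (nextQueue q s a)))
        - (dot (toReal q) (spanProj (toReal q)) + 2 * dot (toReal q) (spanProj (toReal a - schedMat s))
          + dot (toReal a - schedMat s) (spanProj (toReal a - schedMat s)))|
      ≤ 4 * η * coneDist (toReal (nextQueue q s a)) ^ 2
        + (4 * n / η + 3 * n) * dot 1 (unused q s a) := by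
  have hQ := dot_nextQueue_unused q s a
  have hu0 := unused_nonneg q s a
  have hU := one_dot_unused_le q s a
  have hv := toReal_nextQueue q s a
  have hU0 : 0 ≤ dot 1 (unused q s a) := dot_nonneg (fun _ _ => zero_le_one) hu0
  have hunorm : euclNorm (unused q s a) ≤ dot 1 (unused q s a) := by
    rw [one_dot]; exact euclNorm_le_sum _ hu0
  generalize toReal (nextQueue q s a) = v at *
  generalize unused q s a = u at *
  generalize toReal a - schedMat s = b at *
  generalize toReal q = x at *
  set U := dot 1 u with hUdef
  -- With v = x + b + u, the cross terms in u are collected against v rather than x, so that the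
  -- orthogonality of v and u can be used.
  have e : dot v (spanProj v) - (dot x (spanProj x) + 2 * dot x (spanProj b) + dot b (spanProj b))
      = 2 * dot v (spanProj u) - dot u (spanProj u) := by
    have c1 := dot_spanProj_comm b x
    have c2 := dot_spanProj_comm u x
    have c3 := dot_spanProj_comm u b
    rw [hv]
    simp only [spanProj_add, dot_add, add_dot]
    linarith
  have h1 : |dot v (spanProj u)| ≤ 4 * coneDist v * U := by
    have e1 : dot v (spanProj u) = - dot (v - spanProj v) u := by
      rw [dot_spanProj_comm, dot_comm u, sub_dot, hQ]; ring
    rw [e1, abs_neg]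
    exact abs_dot_le_mul_sum (abs_sub_spanProj_le v) hu0
  have h2 : |dot u (spanProj u)| ≤ 3 * U * U := by
    rw [dot_comm]
    refine abs_dot_le_mul_sum (fun i j => (abs_spanProj_le u i j).trans ?_) hu0
    linarith
  have h3 : U * U ≤ n * U := mul_le_mul_of_nonneg_right hU hU0
  -- Young's inequality: a product of distance and unused service becomes a small multiple of the
  -- squared distance plus a term linear in U, since U ≤ n.
  have h4 : 2 * coneDist v * U ≤ η * coneDist v ^ 2 + U * U / η := by
    have h5 : 0 ≤ (η * coneDist v - U) ^ 2 / η := by positivity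
    have e5 : (η * coneDist v - U) ^ 2 / η
        = η * coneDist v ^ 2 - 2 * coneDist v * U + U * U / η := by field_simp; ring
    linarith
  have h6 : U * U / η ≤ n / η * U := by
    rw [div_mul_eq_mul_div]; exact div_le_div_of_nonneg_right h3 hη.le
  rw [e]
  have a1 := abs_le.1 h1
  have a2 := abs_le.1 h2
  have e7 : (4 * (n : ℝ) / η + 3 * n) * U = 4 * (n / η * U) + 3 * (n * U) := by ring
  rw [e7, abs_le]
  constructor <;> linarith

variable {p : Fin n → Fin n → PMF ℕ} {amax : ℕ} {ν k : Fin n → Fin n → ℝ} {ε : ℝ}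

/-- Each variance occurs once in a row sum and once in a column sum, with weight 1/n each, and once
in the total, with weight -1/n². -/
theorem IsArrival.integral_dot_spanProj_centered {lam : Fin n → Fin n → ℝ}
    (h : IsArrival amax lam p) :
    ∫ a, dot (toReal a - lam) (spanProj (toReal a - lam)) ∂arrivalLaw p
      = (2 / n - 1 / (n : ℝ) ^ 2) * ∑ i, ∑ j, arrivalVar p i j := by
  simp only [dot_spanProj, ← sq]
  rw [integral_sub (h.integrable _) (h.integrable _), integral_div, integral_div,
    integral_add (h.integrable _) (h.integrable _), integral_finsetSum _ fun i _ => h.integrable _,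
    integral_finsetSum _ fun i _ => h.integrable _]
  simp only [h.integral_dot_sub_sq]
  have e1 : ∑ i : Fin n, ∑ i', ∑ j', rowInd i i' j' ^ 2 * arrivalVar p i' j'
      = ∑ i, ∑ j, arrivalVar p i j := by
    refine Finset.sum_congr rfl fun i _ => ?_
    simp [rowInd, Finset.sum_ite_irrel]
  have e2 : ∑ j : Fin n, ∑ i', ∑ j', colInd j i' j' ^ 2 * arrivalVar p i' j'
      = ∑ i, ∑ j, arrivalVar p i j := by
    rw [Finset.sum_comm (f := fun i j => arrivalVar p i j)]
    refine Finset.sum_congr rfl fun i _ => ?_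
    simp [colInd]
  rw [e1, e2]
  simp only [Pi.one_apply, one_pow, one_mul]
  ring

/-- `ν` and the schedule have equal row and column sums, so the projected mean drift does not depend
on the schedule. -/
theorem spanProj_mean_sub_schedMat (hr : ∀ i, ∑ j, ν i j = 1) (hc : ∀ j, ∑ i, ν i j = 1)
    (s : Equiv.Perm (Fin n)) :
    spanProj ((fun i j => ν i j - ε * k i j) - schedMat s) = (-ε) • spanProj k := by
  have e : (fun i j => ν i j - ε * k i j) - schedMat s = (ν - schedMat s) + (-ε) • k := by
    funext i j; simp; ring
  rw [e, spanProj_add, spanProj_smul, spanProj_eq_zero, zero_add]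
  · intro i; simp [Finset.sum_sub_distrib, hr, sum_schedMat_row]
  · intro j; simp [Finset.sum_sub_distrib, hc, sum_schedMat_col]

theorem IsArrival.integral_dot_spanProj (h : IsArrival amax (fun i j => ν i j - ε * k i j) p)
    (hr : ∀ i, ∑ j, ν i j = 1) (hc : ∀ j, ∑ i, ν i j = 1) (s : Equiv.Perm (Fin n)) :
    ∫ a, dot (toReal a - schedMat s) (spanProj (toReal a - schedMat s)) ∂arrivalLaw p
      = (2 / n - 1 / (n : ℝ) ^ 2) * ∑ i, ∑ j, arrivalVar p i j + ε ^ 2 * dot k (spanProj k) := by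
  have hs := spanProj_mean_sub_schedMat (ε := ε) (k := k) hr hc s
  set lam : Fin n → Fin n → ℝ := fun i j => ν i j - ε * k i j with hlam
  have e : ∀ a : QueueState n,
      dot (toReal a - schedMat s) (spanProj (toReal a - schedMat s))
        = dot (toReal a - lam) (spanProj (toReal a - lam))
          + (2 * (-ε) * (dot (spanProj k) (toReal a) - dot (spanProj k) lam)
            + ε ^ 2 * dot k (spanProj k)) := by
    intro a
    have e1 : toReal a - schedMat s = (toReal a - lam) + (lam - schedMat s) := by abel
    rw [e1, spanProj_add, dot_add, add_dot, add_dot, dot_spanProj_comm (lam - schedMat s)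
      (toReal a - lam), hs, dot_smul, dot_smul, dot_spanProj_comm (lam - schedMat s) k, hs,
      dot_smul, dot_comm (toReal a - lam) (spanProj k), dot_sub]
    ring
  simp only [e]
  rw [integral_add (h.integrable _) (h.integrable _), h.integral_dot_spanProj_centered,
    integral_add (h.integrable _) (h.integrable _), integral_const_mul,
    integral_sub (h.integrable _) (h.integrable _), h.integral_dot]
  simp

/-- The sign `τ` gives the upper and the lower estimate. The two subtracted terms pay for the unused
service: the squared distance absorbs its coupling to the next state, and the total queue length
turns its amount into a telescoping difference plus the mean `ε * n`. -/
theorem IsArrival.integral_step_le (h : IsArrival amax (fun i j => ν i j - ε * k i j) p)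
    (P : MaxWeight n) (hr : ∀ i, ∑ j, ν i j = 1) (hc : ∀ j, ∑ i, ν i j = 1)
    (hksum : ∑ i, ∑ j, k i j = (n : ℝ)) {η : ℝ} (hη : 0 < η) {τ : ℝ} (hτ : τ = 1 ∨ τ = -1)
    (q : QueueState n) :
    ∫ y, (τ * dot (toReal y) (spanProj (toReal y)) - 4 * η * coneDist (toReal y) ^ 2
        - (4 * n / η + 3 * n) * dot 1 (toReal y)) ∂queueKernel p P q
      ≤ τ * (dot (toReal q) (spanProj (toReal q)) - 2 * ε * dot (toReal q) (spanProj k)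
          + ((2 / n - 1 / (n : ℝ) ^ 2) * ∑ i, ∑ j, arrivalVar p i j + ε ^ 2 * dot k (spanProj k)))
        - (4 * n / η + 3 * n) * dot 1 (toReal q) + (4 * n / η + 3 * n) * (ε * n) := by
  refine h.integral_queueKernel_le P q _ fun s _ => ?_
  set c₂ : ℝ := 4 * n / η + 3 * n with hc₂
  set x := toReal q with hx
  have hpt : ∀ a, τ * dot (toReal (nextQueue q s a)) (spanProj (toReal (nextQueue q s a)))
      - 4 * η * coneDist (toReal (nextQueue q s a)) ^ 2 - c₂ * dot 1 (toReal (nextQueue q s a))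
      ≤ τ * (2 * (dot (spanProj x) (toReal a) - dot (spanProj x) (schedMat s))
          + dot (toReal a - schedMat s) (spanProj (toReal a - schedMat s)))
        - c₂ * dot 1 (toReal a)
        + (τ * dot x (spanProj x) - c₂ * dot 1 x + c₂ * n) := by
    intro a
    have h1 := abs_le.1 (abs_spanProj_step_le q s a hη)
    -- Conservation of packets; each schedule offers `n` units of service.
    have h2 : dot 1 (unused q s a)
        = dot 1 (toReal (nextQueue q s a)) - dot 1 x - dot 1 (toReal a) + n := by
      rw [unused, dot_sub, dot_add, dot_sub, one_dot_schedMat]; ring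
    have h3 : dot x (spanProj (toReal a - schedMat s))
        = dot (spanProj x) (toReal a) - dot (spanProj x) (schedMat s) := by
      rw [dot_spanProj_comm, dot_comm, dot_sub]
    rw [← hx, h2, h3, ← hc₂] at h1
    rcases hτ with rfl | rfl <;> linarith [h1.1, h1.2]
  refine (integral_mono (h.integrable _) (h.integrable _) hpt).trans ?_
  rw [integral_add (h.integrable _) (integrable_const _),
    integral_sub (h.integrable _) (h.integrable _), integral_const_mul, integral_const_mul,
    integral_add (h.integrable _) (h.integrable _), integral_const_mul,
    integral_sub (h.integrable _) (integrable_const _), h.integral_dot, h.integral_dot,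
    h.integral_dot_spanProj hr hc s]
  simp only [integral_const, probReal_univ, smul_eq_mul, one_mul]
  rw [← dot_sub, dot_comm (spanProj x), dot_spanProj_comm, spanProj_mean_sub_schedMat hr hc,
    dot_smul]
  have e1 : dot 1 (fun i j => ν i j - ε * k i j) = n - ε * n := by
    rw [one_dot]
    simp [Finset.sum_sub_distrib, hr, ← Finset.mul_sum, hksum]
  rw [e1]
  refine le_of_eq ?_
  ring

theorem exists_pos_forall_le {ι : Type*} [Finite ι] (f : ι → ℝ) (hf : ∀ i, 0 < f i) :
    ∃ c, 0 < c ∧ ∀ i, c ≤ f i := by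
  cases isEmpty_or_nonempty ι
  · exact ⟨1, one_pos, fun i => isEmptyElim i⟩
  · obtain ⟨i, hi⟩ := Finite.exists_min f
    exact ⟨f i, hf i, hi⟩

theorem exists_margin {lam : Fin n → Fin n → ℝ} (hr : ∀ i, ∑ j, lam i j < 1)
    (hc : ∀ j, ∑ i, lam i j < 1) :
    ∃ c, 0 < c ∧ (∀ i, ∑ j, (lam i j + c) ≤ 1) ∧ ∀ j, ∑ i, (lam i j + c) ≤ 1 := by
  obtain ⟨c₁, h₁, h₁'⟩ := exists_pos_forall_le (fun i => (1 - ∑ j, lam i j) / n) fun i =>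
    div_pos (sub_pos.2 (hr i)) (Nat.cast_pos.2 i.pos)
  obtain ⟨c₂, h₂, h₂'⟩ := exists_pos_forall_le (fun j => (1 - ∑ i, lam i j) / n) fun j =>
    div_pos (sub_pos.2 (hc j)) (Nat.cast_pos.2 j.pos)
  refine ⟨min c₁ c₂, lt_min h₁ h₂, fun i => ?_, fun j => ?_⟩
  · have := (min_le_left c₁ c₂).trans (h₁' i)
    rw [le_div_iff₀ (Nat.cast_pos.2 i.pos)] at this
    simp only [Finset.sum_add_distrib, Finset.sum_const, Finset.card_univ, Fintype.card_fin,
      nsmul_eq_mul]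
    linarith
  · have := (min_le_right c₁ c₂).trans (h₂' j)
    rw [le_div_iff₀ (Nat.cast_pos.2 j.pos)] at this
    simp only [Finset.sum_add_distrib, Finset.sum_const, Finset.card_univ, Fintype.card_fin,
      nsmul_eq_mul]
    linarith

/-- For n ≥ 2 another positive entry of the row forces `ν i j < 1`; for n = 1 the only entry of `k`
is 1. -/
theorem mean_lt_one (hr : ∀ i, ∑ j, ν i j = 1) (hν : ∀ i j, 0 < ν i j) (hk : ∀ i j, 0 ≤ k i j)
    (hksum : ∑ i, ∑ j, k i j = (n : ℝ)) (hε : 0 < ε) (i j : Fin n) : ν i j - ε * k i j < 1 := by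
  by_contra! hge
  have h1 : ν i j ≤ 1 := hr i ▸ Finset.single_le_sum (fun j _ => (hν i j).le) (Finset.mem_univ j)
  have h2 : k i j = 0 := by
    refine le_antisymm ?_ (hk i j)
    by_contra! hpos
    linarith [mul_pos hε hpos]
  by_cases hj : ∃ j', j' ≠ j
  · obtain ⟨j', hj'⟩ := hj
    have h3 : ∑ l ∈ {j, j'}, ν i l ≤ ∑ l, ν i l :=
      Finset.sum_le_sum_of_subset_of_nonneg (Finset.subset_univ _) fun l _ _ => (hν i l).le
    rw [Finset.sum_pair hj'.symm, hr i] at h3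
    rw [h2] at hge
    linarith [hν i j']
  · push Not at hj
    have h3 : ∑ i', ∑ j', k i' j' = 0 :=
      Finset.sum_eq_zero fun i' _ => Finset.sum_eq_zero fun j' _ => by
        rw [hj j', (hj i').trans (hj i).symm, h2]
    rw [h3] at hksum
    exact (Nat.cast_pos.2 i.pos).ne hksum

end HeavyTraffic

/-! ### Stationary estimates and the error term -/

section Bounds

variable {n : ℕ} {p : Fin n → Fin n → PMF ℕ} {amax : ℕ} {ν k : Fin n → Fin n → ℝ} {ε : ℝ}

theorem integrable_of_abs_le_sq {μ : Measure (QueueState n)} [IsProbabilityMeasure μ]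
    (h2 : Integrable (fun q => euclNorm (toReal q) ^ 2) μ) {f : QueueState n → ℝ} {C : ℝ}
    (hf : ∀ q, |f q| ≤ C * (1 + euclNorm (toReal q) ^ 2)) : Integrable f μ :=
  (((integrable_const (1 : ℝ)).add h2).const_mul C).mono'
    Measurable.of_discrete.aestronglyMeasurable (ae_of_all _ hf)

theorem integrable_dot {μ : Measure (QueueState n)} [IsProbabilityMeasure μ]
    (h2 : Integrable (fun q => euclNorm (toReal q) ^ 2) μ) (w : Fin n → Fin n → ℝ) :
    Integrable (fun q => dot (toReal q) w) μ := by
  refine integrable_of_abs_le_sq h2 (C := euclNorm w) fun q => (abs_dot_le _ _).trans ?_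
  rw [mul_comm]
  refine mul_le_mul_of_nonneg_left ?_ (euclNorm_nonneg _)
  nlinarith [sq_nonneg (euclNorm (toReal q) - 1), euclNorm_nonneg (toReal q)]

theorem integrable_dot_spanProj {μ : Measure (QueueState n)} [IsProbabilityMeasure μ]
    (h2 : Integrable (fun q => euclNorm (toReal q) ^ 2) μ) :
    Integrable (fun q => dot (toReal q) (spanProj (toReal q))) μ := by
  refine integrable_of_abs_le_sq h2 (C := 3 * (n : ℝ) ^ 2) fun q => ?_
  set x := toReal q
  rw [dot_comm]
  refine (abs_dot_le_mul_sum (abs_spanProj_le x) fun i j => Nat.cast_nonneg _).trans ?_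
  have h1 : dot 1 x ≤ (n : ℝ) ^ 2 * euclNorm x := by
    rw [one_dot]
    calc _ ≤ ∑ _i : Fin n, ∑ _j : Fin n, euclNorm x :=
          Finset.sum_le_sum fun i _ => Finset.sum_le_sum fun j _ =>
            (le_abs_self _).trans (abs_apply_le_euclNorm x i j)
      _ = _ := by simp; ring
  calc 3 * euclNorm x * dot 1 x ≤ 3 * euclNorm x * ((n : ℝ) ^ 2 * euclNorm x) :=
        mul_le_mul_of_nonneg_left h1 (mul_nonneg (by norm_num) (euclNorm_nonneg x))
    _ = 3 * (n : ℝ) ^ 2 * euclNorm x ^ 2 := by ring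
    _ ≤ _ := by
        refine mul_le_mul_of_nonneg_left ?_ (by positivity)
        linarith

/-- The uniform bound on the second moment of the distance to the collapse cone. -/
noncomputable def collapseBound (n amax : ℕ) (m : ℝ) : ℝ :=
  ((3 / 2 * ((n : ℝ) ^ 2 * ((amax : ℝ) + 1) ^ 2 + (n * ((amax : ℝ) + 1)) ^ 2)) ^ 2
    / (4 * (m / 2)) + (n * ((amax : ℝ) + 1)) ^ 3) / (2 * (m / 2))

/-- The drift identity for the projection to the span of the collapse cone, up to small terms. -/
theorem IsSteadyState.abs_drift_le (h : IsArrival amax (fun i j => ν i j - ε * k i j) p)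
    {P : MaxWeight n} {μ : Measure (QueueState n)} (hμ : IsSteadyState p P μ)
    (h2 : Integrable (fun q => euclNorm (toReal q) ^ 2) μ) {M : ℝ}
    (hD : Integrable (fun q => coneDist (toReal q) ^ 2) μ)
    (hM : ∫ q, coneDist (toReal q) ^ 2 ∂μ ≤ M)
    (hr : ∀ i, ∑ j, ν i j = 1) (hc : ∀ j, ∑ i, ν i j = 1)
    (hksum : ∑ i, ∑ j, k i j = (n : ℝ)) {η : ℝ} (hη : 0 < η) :
    |(2 / n - 1 / (n : ℝ) ^ 2) * ∑ i, ∑ j, arrivalVar p i j + ε ^ 2 * dot k (spanProj k)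
      - 2 * ε * ∫ q, dot (toReal q) (spanProj k) ∂μ|
      ≤ 4 * η * M + (4 * n / η + 3 * n) * (ε * n) := by
  have := hμ.1
  set W : ℝ := (2 / n - 1 / (n : ℝ) ^ 2) * ∑ i, ∑ j, arrivalVar p i j
    + ε ^ 2 * dot k (spanProj k) with hW
  set c₂ : ℝ := 4 * n / η + 3 * n with hc₂
  have iQ := integrable_dot_spanProj h2
  have iT : Integrable (fun q => dot 1 (toReal q)) μ := by
    simpa only [dot_comm] using integrable_dot h2 1
  have iK := integrable_dot h2 (spanProj k)
  have key : ∀ τ : ℝ, τ = 1 ∨ τ = -1 →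
      0 ≤ τ * (W - 2 * ε * ∫ q, dot (toReal q) (spanProj k) ∂μ) + (4 * η * M + c₂ * (ε * n)) := by
    intro τ hτ
    have iΦ : Integrable (fun q => τ * dot (toReal q) (spanProj (toReal q))
        - 4 * η * coneDist (toReal q) ^ 2 - c₂ * dot 1 (toReal q)) μ :=
      ((iQ.const_mul τ).sub (hD.const_mul (4 * η))).sub (iT.const_mul c₂)
    obtain ⟨j1, j2⟩ := integral_integral_of_invariant hμ.2 iΦ
    have iR : Integrable (fun q => τ * (dot (toReal q) (spanProj (toReal q))
        - 2 * ε * dot (toReal q) (spanProj k) + W) - c₂ * dot 1 (toReal q) + c₂ * (ε * n)) μ :=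
      ((((iQ.sub (iK.const_mul (2 * ε))).add (integrable_const W)).const_mul τ).sub
        (iT.const_mul c₂)).add (integrable_const _)
    have hle := integral_mono j1 iR fun q => h.integral_step_le P hr hc hksum hη hτ q
    have i1 : Integrable (fun q => τ * dot (toReal q) (spanProj (toReal q))
        - 4 * η * coneDist (toReal q) ^ 2) μ := (iQ.const_mul τ).sub (hD.const_mul (4 * η))
    have i2 : Integrable (fun q => dot (toReal q) (spanProj (toReal q))
        - 2 * ε * dot (toReal q) (spanProj k)) μ := iQ.sub (iK.const_mul (2 * ε))
    have i3 : Integrable (fun q => dot (toReal q) (spanProj (toReal q))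
        - 2 * ε * dot (toReal q) (spanProj k) + W) μ := i2.add (integrable_const W)
    have i4 : Integrable (fun q => τ * (dot (toReal q) (spanProj (toReal q))
        - 2 * ε * dot (toReal q) (spanProj k) + W) - c₂ * dot 1 (toReal q)) μ :=
      (i3.const_mul τ).sub (iT.const_mul c₂)
    -- After integration the terms with ⟨q, Πq⟩ and with the total queue length occur on both sides
    -- and cancel; their finiteness comes from `h2`.
    rw [j2, integral_sub i1 (iT.const_mul c₂), integral_sub (iQ.const_mul τ) (hD.const_mul (4 * η)),
      integral_add i4 (integrable_const _), integral_sub (i3.const_mul τ) (iT.const_mul c₂),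
      integral_const_mul τ, integral_const_mul τ, integral_add i2 (integrable_const W),
      integral_sub iQ (iK.const_mul (2 * ε))] at hle
    simp only [integral_const_mul, integral_const, probReal_univ, smul_eq_mul, one_mul] at hle
    have hM' := mul_le_mul_of_nonneg_left hM (by positivity : 0 ≤ 4 * η)
    linarith
  have k1 := key 1 (Or.inl rfl)
  have k2 := key (-1) (Or.inr rfl)
  rw [abs_le]
  constructor <;> linarith

/-- `α` and `n • spanProj k` have the same row and column sums, so their difference is orthogonal to
the cone and only the residual of `x` contributes. -/
theorem abs_dot_sub_le {α : Fin n → Fin n → ℝ} (hαr : ∀ i, ∑ j, α i j = n * ∑ j, k i j)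
    (hαc : ∀ j, ∑ i, α i j = n * ∑ i, k i j) (hksum : ∑ i, ∑ j, k i j = (n : ℝ))
    (x : Fin n → Fin n → ℝ) :
    |dot x α - n * dot x (spanProj k)|
      ≤ coneDist x * euclNorm (α - (n : ℝ) • spanProj k) := by
  have hksum' : ∑ j, ∑ i, k i j = (n : ℝ) := by rw [Finset.sum_comm, hksum]
  have e : dot x α - n * dot x (spanProj k)
      = dot (x - coneProj x) (α - (n : ℝ) • spanProj k) := by
    have h0 : dot (coneProj x) (α - (n : ℝ) • spanProj k) = 0 := by
      refine dot_eq_zero_of_mem_collapseCone (coneProj_mem x) (fun i => ?_) (fun j => ?_)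
      · have hn : (n : ℝ) ≠ 0 := Nat.cast_ne_zero.2 i.pos.ne'
        simp only [Pi.sub_apply, Pi.smul_apply, smul_eq_mul, spanProj, Finset.sum_sub_distrib,
          ← Finset.mul_sum, ← Finset.sum_div, Finset.sum_add_distrib, dot_rowInd, dot_colInd,
          one_dot, hksum, hksum', hαr]
        simp
        field_simp
        ring
      · have hn : (n : ℝ) ≠ 0 := Nat.cast_ne_zero.2 j.pos.ne'
        simp only [Pi.sub_apply, Pi.smul_apply, smul_eq_mul, spanProj, Finset.sum_sub_distrib,
          ← Finset.mul_sum, ← Finset.sum_div, Finset.sum_add_distrib, dot_rowInd, dot_colInd,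
          one_dot, hksum, hαc]
        simp
        field_simp
        ring
    rw [sub_dot, h0, sub_zero, dot_sub, dot_smul]
  rw [e]
  exact abs_dot_le _ _

/-- The error in the heavy-traffic approximation of the mean weighted queue length. -/
noncomputable def errorBound (amax : ℕ) (ν k α : Fin n → Fin n → ℝ) (ε : ℝ) : ℝ :=
  euclNorm (α - (n : ℝ) • spanProj k) * (1 + collapseBound n amax (minEntry ν))
    + n / (2 * ε) * (ε ^ 2 * |dot k (spanProj k)|
      + (4 * √ε * collapseBound n amax (minEntry ν) + (4 * n / √ε + 3 * n) * (ε * n)))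

/-- With η = √ε both competing terms, proportional to η and to ε/η, are of order √ε. -/
theorem tendsto_mul_errorBound (amax : ℕ) (ν k α : Fin n → Fin n → ℝ) :
    Tendsto (fun ε => ε * errorBound amax ν k α ε) (𝓝[>] 0) (𝓝 0) := by
  set A := euclNorm (α - (n : ℝ) • spanProj k) * (1 + collapseBound n amax (minEntry ν)) with hA
  set M := collapseBound n amax (minEntry ν) with hM
  have h1 : Tendsto (fun ε : ℝ => ε * A + n / 2 * (ε ^ 2 * |dot k (spanProj k)|
      + (4 * √ε * M + (4 * n * √ε + 3 * n * ε) * n))) (𝓝[>] 0) (𝓝 0) := by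
    have hcont : Continuous (fun ε : ℝ => ε * A + n / 2 * (ε ^ 2 * |dot k (spanProj k)|
      + (4 * √ε * M + (4 * n * √ε + 3 * n * ε) * n))) := by fun_prop
    have := (hcont.tendsto 0).mono_left (nhdsWithin_le_nhds (s := Set.Ioi 0))
    simpa using this
  refine h1.congr' ?_
  filter_upwards [self_mem_nhdsWithin] with ε hε
  have hε : (0 : ℝ) < ε := hε
  have hs : 0 < √ε := Real.sqrt_pos.2 hε
  have hss : ε / √ε = √ε := Real.div_sqrt
  have e : (4 * (n : ℝ) / √ε + 3 * n) * (ε * n) = (4 * n * √ε + 3 * n * ε) * n := by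
    conv_rhs => rw [← hss]
    field_simp
  rw [errorBound, e, ← hA, ← hM]
  field_simp

theorem minEntry_le (ν : Fin n → Fin n → ℝ) (i j : Fin n) : minEntry ν ≤ ν i j :=
  ciInf_le (Finite.bddBelow_range fun ij : Fin n × Fin n => ν ij.1 ij.2) (i, j)

theorem euclNorm_pos (hn : 1 ≤ n) (hksum : ∑ i, ∑ j, k i j = (n : ℝ)) : 0 < euclNorm k := by
  refine lt_of_le_of_ne (euclNorm_nonneg k) fun h0 => ?_
  have hk0 : ∀ i j, k i j = 0 := fun i j =>
    abs_eq_zero.1 (le_antisymm (h0 ▸ abs_apply_le_euclNorm k i j) (abs_nonneg _))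
  simp only [hk0, Finset.sum_const_zero] at hksum
  have : (1 : ℝ) ≤ n := by exact_mod_cast hn
  linarith

theorem mul_euclNorm_le (hn : 1 ≤ n) (hksum : ∑ i, ∑ j, k i j = (n : ℝ))
    (hε : ε ≤ epsMax ν k) : ε * euclNorm k ≤ minEntry ν / 2 := by
  have hk := euclNorm_pos hn hksum
  rw [epsMax, le_div_iff₀ (by positivity)] at hε
  linarith

theorem IsSteadyState.abs_integral_sub_le (hn : 1 ≤ n) (hνmin : 0 < minEntry ν)
    (hr : ∀ i, ∑ j, ν i j = 1) (hc : ∀ j, ∑ i, ν i j = 1) (hk : ∀ i j, 0 ≤ k i j)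
    (hksum : ∑ i, ∑ j, k i j = (n : ℝ)) {α : Fin n → Fin n → ℝ}
    (hαr : ∀ i, ∑ j, α i j = n * ∑ j, k i j) (hαc : ∀ j, ∑ i, α i j = n * ∑ i, k i j)
    (hε : ε ∈ Set.Ioc 0 (epsMax ν k)) (h : IsArrival amax (fun i j => ν i j - ε * k i j) p)
    {P : MaxWeight n} {μ : Measure (QueueState n)} (hμ : IsSteadyState p P μ) :
    Integrable (weightedSum α) μ ∧
      |∫ q, weightedSum α q ∂μ - (1 - 1 / (2 * (n : ℝ))) * (∑ i, ∑ j, arrivalVar p i j) / ε|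
        ≤ errorBound amax ν k α ε := by
  have := hμ.1
  have hε0 : 0 < ε := hε.1
  have hn0 : (0 : ℝ) < n := Nat.cast_pos.2 hn
  have hlt := mean_lt_one hr (fun i j => hνmin.trans_le (minEntry_le ν i j)) hk hksum hε0
  -- Some port may have no slack built into `k`; strict underload is deduced from the existence of
  -- the steady state `μ`.
  obtain ⟨c, hc0, hcr, hcc⟩ := exists_margin (IsSteadyState.sum_row_lt_one h hlt hμ)
    (IsSteadyState.sum_col_lt_one h hlt hμ)
  have h2 := IsSteadyState.integrable_euclNorm_sq h hμ hc0 hcr hcc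
  obtain ⟨hD, hM⟩ := IsSteadyState.coneDist_sq h hμ hνmin (minEntry_le ν) hr hc hε0.le
    (mul_euclNorm_le hn hksum hε.2)
  change _ ≤ collapseBound n amax (minEntry ν) at hM
  have hdrift := IsSteadyState.abs_drift_le h hμ h2 hD hM hr hc hksum (Real.sqrt_pos.2 hε0)
  have iα : Integrable (weightedSum α) μ := integrable_dot h2 α
  refine ⟨iα, ?_⟩
  rw [errorBound]
  set M := collapseBound n amax (minEntry ν)
  set A := euclNorm (α - (n : ℝ) • spanProj k)
  set E := 4 * √ε * M + (4 * n / √ε + 3 * n) * (ε * n)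
  set S := ∑ i, ∑ j, arrivalVar p i j
  set I := ∫ q, dot (toReal q) (spanProj k) ∂μ
  have hA : 0 ≤ A := euclNorm_nonneg _
  have h3 : |∫ q, weightedSum α q ∂μ - n * I| ≤ A * (1 + M) := by
    have e : ∫ q, weightedSum α q ∂μ - n * I
        = ∫ q, (weightedSum α q - n * dot (toReal q) (spanProj k)) ∂μ := by
      rw [integral_sub iα ((integrable_dot h2 _).const_mul _), integral_const_mul]
    rw [e]
    calc _ ≤ ∫ q, |weightedSum α q - n * dot (toReal q) (spanProj k)| ∂μ :=
          abs_integral_le_integral_abs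
      _ ≤ ∫ q, A * (1 + coneDist (toReal q) ^ 2) ∂μ := by
          refine integral_mono (iα.sub ((integrable_dot h2 _).const_mul _)).abs
            (((integrable_const _).add hD).const_mul _) fun q => ?_
          refine (abs_dot_sub_le hαr hαc hksum (toReal q)).trans ?_
          rw [mul_comm]
          refine mul_le_mul_of_nonneg_left ?_ hA
          nlinarith [sq_nonneg (coneDist (toReal q) - 1), coneDist_nonneg (toReal q)]
      _ ≤ A * (1 + M) := by
          rw [integral_const_mul, integral_add (integrable_const _) hD]
          simp only [integral_const, probReal_univ, smul_eq_mul, one_mul]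
          exact mul_le_mul_of_nonneg_left (by linarith) hA
  have h4 : |n * I - (1 - 1 / (2 * (n : ℝ))) * S / ε|
      ≤ n / (2 * ε) * (ε ^ 2 * |dot k (spanProj k)| + E) := by
    -- The drift identity is scaled by n/(2ε), and (n/2)(2/n - 1/n²) = 1 - 1/(2n).
    have e : n * I - (1 - 1 / (2 * (n : ℝ))) * S / ε = n / (2 * ε) * (ε ^ 2 * dot k (spanProj k)
        - ((2 / n - 1 / (n : ℝ) ^ 2) * S + ε ^ 2 * dot k (spanProj k) - 2 * ε * I)) := by
      field_simp
      ring
    rw [e, abs_mul, abs_of_pos (by positivity : 0 < (n : ℝ) / (2 * ε))]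
    refine mul_le_mul_of_nonneg_left ((abs_sub _ _).trans (add_le_add ?_ hdrift)) (by positivity)
    rw [abs_mul, abs_of_nonneg (sq_nonneg ε)]
  calc _ = |(∫ q, weightedSum α q ∂μ - n * I) + (n * I - (1 - 1 / (2 * (n : ℝ))) * S / ε)| := by
        congr 1; ring
    _ ≤ _ := (abs_add_le _ _).trans (add_le_add h3 h4)

end Bounds

end Switch

/-! ### The main theorem -/

theorem mainTheorem4 (n : ℕ) (hn : 1 ≤ n) (ν k : Fin n → Fin n → ℝ)
    (hν : ν ∈ intrinsicInterior ℝ (Switch.saturatedFace n n n))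
    (hνmin : 0 < Switch.minEntry ν)
    (hk : ∀ i j, 0 ≤ k i j) (hksum : ∑ i, ∑ j, k i j = (n : ℝ)) (amax : ℕ) :
    -- if all ports are underloaded, the chain has exactly one steady state
    ((∀ i, 0 < ∑ j, k i j) → (∀ j, 0 < ∑ i, k i j) →
      ∀ ε ∈ Set.Ioc 0 (Switch.epsMax ν k), ∀ (p : Fin n → Fin n → PMF ℕ) (P : Switch.MaxWeight n),
        Switch.IsArrival amax (fun i j => ν i j - ε * k i j) p →
        ∃! μ : MeasureTheory.Measure (Switch.QueueState n), Switch.IsSteadyState p P μ) ∧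
    ∀ α : Fin n → Fin n → ℝ,
      (∀ i, ∑ j, α i j = n * ∑ j, k i j) → (∀ j, ∑ i, α i j = n * ∑ i, k i j) →
      -- two-sided bounds for each system
      (∃ B₃ B₄ : ℝ → ℝ,
        Filter.Tendsto (fun ε => ε * B₃ ε) (nhdsWithin 0 (Set.Ioi 0)) (nhds 0) ∧
        Filter.Tendsto (fun ε => ε * B₄ ε) (nhdsWithin 0 (Set.Ioi 0)) (nhds 0) ∧
        ∀ ε ∈ Set.Ioc 0 (Switch.epsMax ν k),
          ∀ (p : Fin n → Fin n → PMF ℕ) (P : Switch.MaxWeight n)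
            (μ : MeasureTheory.Measure (Switch.QueueState n)),
            Switch.IsArrival amax (fun i j => ν i j - ε * k i j) p →
            Switch.IsSteadyState p P μ →
            MeasureTheory.Integrable (Switch.weightedSum α) μ ∧
            (1 - 1 / (2 * (n : ℝ))) * (∑ i, ∑ j, Switch.arrivalVar p i j) / ε - B₃ ε
              ≤ ∫ q, Switch.weightedSum α q ∂μ ∧
            ∫ q, Switch.weightedSum α q ∂μ
              ≤ (1 - 1 / (2 * (n : ℝ))) * (∑ i, ∑ j, Switch.arrivalVar p i j) / ε + B₄ ε) ∧
      -- the heavy-traffic limit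
      (∀ (p : ℝ → Fin n → Fin n → PMF ℕ) (P : ℝ → Switch.MaxWeight n)
        (μ : ℝ → MeasureTheory.Measure (Switch.QueueState n)) (σsq : Fin n → Fin n → ℝ),
        (∀ ε ∈ Set.Ioc 0 (Switch.epsMax ν k),
          Switch.IsArrival amax (fun i j => ν i j - ε * k i j) (p ε) ∧
          Switch.IsSteadyState (p ε) (P ε) (μ ε)) →
        (∀ i j, Filter.Tendsto (fun ε => Switch.arrivalVar (p ε) i j)
          (nhdsWithin 0 (Set.Ioi 0)) (nhds (σsq i j))) →
        Filter.Tendsto (fun ε => ε * ∫ q, Switch.weightedSum α q ∂(μ ε))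
          (nhdsWithin 0 (Set.Ioi 0))
          (nhds ((1 - 1 / (2 * (n : ℝ))) * ∑ i, ∑ j, σsq i j))) := by
  have hface := intrinsicInterior_subset hν
  have hr : ∀ i, ∑ j, ν i j = 1 := fun i => hface.2.1 i i.isLt
  have hc : ∀ j, ∑ i, ν i j = 1 := fun j => hface.2.2 j j.isLt
  refine ⟨fun hκ hκ' ε hε p P h => ?_, fun α hαr hαc => ⟨?_, ?_⟩⟩
  · have hlt := Switch.mean_lt_one hr (fun i j => hνmin.trans_le (Switch.minEntry_le ν i j)) hk
      hksum hε.1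
    -- Each port has slack ε times its row or column sum of `k`, which is positive here.
    obtain ⟨c, hc0, hcr, hcc⟩ := Switch.exists_margin (lam := fun i j => ν i j - ε * k i j)
      (fun i => by
        rw [Finset.sum_sub_distrib, hr, ← Finset.mul_sum]
        linarith [mul_pos hε.1 (hκ i)])
      (fun j => by
        rw [Finset.sum_sub_distrib, hc, ← Finset.mul_sum]
        linarith [mul_pos hε.1 (hκ' j)])
    exact h.existsUnique_isSteadyState hlt P hc0 hcr hcc
  · refine ⟨Switch.errorBound amax ν k α, Switch.errorBound amax ν k α,
      Switch.tendsto_mul_errorBound amax ν k α, Switch.tendsto_mul_errorBound amax ν k α,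
      fun ε hε p P μ h hμ => ?_⟩
    obtain ⟨h1, h2⟩ := hμ.abs_integral_sub_le hn hνmin hr hc hk hksum hαr hαc hε h
    have := abs_le.1 h2
    exact ⟨h1, by linarith, by linarith⟩
  · intro p P μ σsq hsys hσ
    have hmax : 0 < Switch.epsMax ν k :=
      div_pos hνmin (mul_pos two_pos (Switch.euclNorm_pos hn hksum))
    have hvar : Filter.Tendsto
        (fun ε => (1 - 1 / (2 * (n : ℝ))) * ∑ i, ∑ j, Switch.arrivalVar (p ε) i j)
        (nhdsWithin 0 (Set.Ioi 0)) (nhds ((1 - 1 / (2 * (n : ℝ))) * ∑ i, ∑ j, σsq i j)) :=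
      (tendsto_finsetSum _ fun i _ => tendsto_finsetSum _ fun j _ => hσ i j).const_mul _
    have herr := Switch.tendsto_mul_errorBound amax ν k α
    have hlow := hvar.sub herr
    have hupp := hvar.add herr
    rw [sub_zero] at hlow
    rw [add_zero] at hupp
    -- The limit needs the error only after multiplication by ε, where it vanishes, so a squeeze
    -- against the converging variances suffices.
    have hbd : ∀ᶠ ε in nhdsWithin (0 : ℝ) (Set.Ioi 0),
        |ε * ∫ q, Switch.weightedSum α q ∂(μ ε)
          - (1 - 1 / (2 * (n : ℝ))) * ∑ i, ∑ j, Switch.arrivalVar (p ε) i j|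
          ≤ ε * Switch.errorBound amax ν k α ε := by
      filter_upwards [Ioc_mem_nhdsGT hmax] with ε hε
      have hε0 : 0 < ε := hε.1
      obtain ⟨h, hμ⟩ := hsys ε hε
      have h2 := (hμ.abs_integral_sub_le hn hνmin hr hc hk hksum hαr hαc hε h).2
      have h3 := mul_le_mul_of_nonneg_left h2 hε0.le
      rw [← abs_of_pos hε0, abs_of_pos hε0] at h3
      rw [← abs_of_pos hε0, ← abs_mul, abs_of_pos hε0, mul_sub, mul_div_cancel₀ _ hε0.ne'] at h3
      exact h3
    refine tendsto_of_tendsto_of_tendsto_of_le_of_le' hlow hupp ?_ ?_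
    · filter_upwards [hbd] with ε h
      linarith [(abs_le.1 h).1]
    · filter_upwards [hbd] with ε h
      linarith [(abs_le.1 h).2]
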